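/- Let $\mathcal D'$ be the space of real Schwartz distributions on $\mathbb R$, with distributional derivative $D_x$; locally integrable functions are identified with regular distributions. Let $\mathcal C^\infty_p$ be the space of piecewise smooth functions: $f\in\mathcal C^\infty_p$ iff there is a finite set $I\subset\mathbb R$ such that $f$ is smooth on $\mathbb R\setminus I$ and $\lim_{x\to x_0^\pm}f^{(n)}(x)$ exist and are finite for all $x_0\in I$, $n\ge 0$. Let $\mathcal A=\bigcup_{i\ge 0}D_x^i[\mathcal C^\infty_p]\subset\mathcal D'$. Every $F\in\mathcal A$ can be written $F=f+\sum_{x\in I_F}\Delta^F_x$, where $f\in\mathcal C^\infty_p$, $I_F$ is finite and each $\Delta^F_x$ is a non-zero finite linear combination of derivatives of the Dirac measure $\delta_x$. If $F,G\in\mathcal D'$ have finite disjoint singular supports, their Hörmander product $F\cdot G$ is the distribution which, on each member of a finite open covering of $\mathbb R$ on which $F$ or $G$ is smooth, is the product of the smooth factor by the other distribution. For $F,G\in\mathcal A$ put $F*G=\lim_{\varepsilon\downarrow 0}F(x)\cdot G(x+\varepsilon)$ (limit in the distributional sense), and for $M\subseteq\mathbb R$ $$F*_MG=fg+\sum_{y\in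 I_G\cap M}f*\Delta^G_y+\sum_{x\in I_F\cap M}\Delta^F_x*g+\sum_{y\in I_G\setminus M}\Delta^G_y*f+\sum_{x\in I_F\setminus M}g*\Delta^F_x .$$ Let $\circledast:\mathcal A\times\mathcal A\to\mathcal A$ be an associative bilinear product such that: (A2) the function $1$ is the identity of $(\mathcal A,+,\circledast)$; (A3) there is a linear operator $D:\mathcal A\to\mathcal A$ that satisfies the Leibniz rule $D(F\circledast G)=DF\circledast G+F\circledast DG$ and coincides with $D_x$ on $\mathcal A$; (A4) $F\circledast G$ is the usual product $fg$ whenever $F=f$ and $G=g$ are continuous functions belonging to $\mathcal A$. Then there is a set $M\subseteq\mathbb R$ such that $\circledast=*_M$, that is, $F\circledast G=F*_MG$ for all $F,G\in\mathcal A$. -/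

import Mathlib

open scoped Distributions ContDiff Topology LineDeriv
open Set Filter MeasureTheory

namespace DistAlg

/-- The space `D` of real test functions on `ℝ` (smooth, compactly supported). -/
abbrev Test : Type := 𝓓((⊤ : TopologicalSpace.Opens ℝ), ℝ)

/-- The space `D'` of (real) Schwartz distributions on `ℝ`. -/
abbrev Dist : Type := 𝓓'((⊤ : TopologicalSpace.Opens ℝ), ℝ)

/-- The distributional derivative `D_x`, i.e. `⟨D_x F, t⟩ = -⟨F, t'⟩`. -/
noncomputable def Dx : Dist →ₗ[ℝ] Dist :=
  (Distribution.lineDerivCLM (1 : ℝ) : Dist →L[ℝ] Dist).toLinearMap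

theorem Dx_eq (F : Dist) : Dx F = ∂_{(1 : ℝ)} F := rfl

theorem Dx_apply (F : Dist) (t s : Test) (hs : ∀ x, s x = deriv t x) : Dx F t = - F s := by
  have h : TestFunction.lineDerivCLM ℝ (1 : ℝ) t = s := by
    ext x
    simp [hs x, lineDeriv, deriv_comp_const_add]
  change - F (TestFunction.lineDerivCLM ℝ (1 : ℝ) t) = - F s
  rw [h]

/-- The regular distribution `⟨f, t⟩ = ∫ f(x) t(x) dx` of a locally integrable function `f`
(by convention it is `0` if `f` is not locally integrable). -/
noncomputable def regular (f : ℝ → ℝ) : Dist :=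
  (TestFunction.integralAgainstBilinCLM (ContinuousLinearMap.mul ℝ ℝ) volume f :
    Test →L[ℝ] ℝ)

theorem regular_apply {f : ℝ → ℝ} (hf : LocallyIntegrable f) (t : Test) :
    regular f t = ∫ x, f x * t x := by
  have hf' : LocallyIntegrableOn f ((⊤ : TopologicalSpace.Opens ℝ) : Set ℝ) volume :=
    hf.locallyIntegrableOn _
  have h := TestFunction.integralAgainstBilinCLM_eq_integral
    (B := ContinuousLinearMap.mul ℝ ℝ) (n := ⊤) hf' (f := t)
  refine Eq.trans h ?_
  simp [mul_comm]

/-- The space of piecewise smooth functions: `f` is smooth off a finite set `I`, and at the points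
of `I` all derivatives of `f` have finite one-sided limits. -/
def PiecewiseSmooth (f : ℝ → ℝ) : Prop :=
  ∃ I : Finset ℝ, ContDiffOn ℝ ∞ f (I : Set ℝ)ᶜ ∧
    ∀ x₀ ∈ I, ∀ n : ℕ,
      (∃ l : ℝ, Tendsto (iteratedDeriv n f) (𝓝[<] x₀) (𝓝 l)) ∧
      (∃ r : ℝ, Tendsto (iteratedDeriv n f) (𝓝[>] x₀) (𝓝 r))

/-- The space `𝒜` of all distributional derivatives (of every order) of piecewise smooth functions,
as a linear subspace of `D'`: the smallest one that contains the piecewise smooth functions and is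
stable under `D_x`. (A primitive of a piecewise smooth function is piecewise smooth, so the union
below is already a linear subspace, and the span only bundles it as such.) -/
noncomputable def 𝒜 : Submodule ℝ Dist :=
  Submodule.span ℝ (⋃ i : ℕ, {F : Dist | ∃ f : ℝ → ℝ, PiecewiseSmooth f ∧ F = Dx^[i] (regular f)})

theorem regular_mem {f : ℝ → ℝ} (hf : PiecewiseSmooth f) : regular f ∈ 𝒜 :=
  Submodule.subset_span (mem_iUnion.2 ⟨0, f, hf, rfl⟩)

theorem piecewiseSmooth_of_contDiff {f : ℝ → ℝ} (hf : ContDiff ℝ ∞ f) : PiecewiseSmooth f :=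
  ⟨∅, hf.contDiffOn, by simp⟩

/-- The constant function `1`, as an element of `𝒜`. -/
noncomputable def one : 𝒜 :=
  ⟨regular (fun _ => 1), regular_mem (piecewiseSmooth_of_contDiff contDiff_const)⟩

/-- The test function `x ↦ t (x - a)`. -/
noncomputable def shiftTest (a : ℝ) (t : Test) : Test where
  toFun x := t (x - a)
  contDiff' := t.contDiff.comp (contDiff_id.sub contDiff_const)
  hasCompactSupport' := by
    have h := t.hasCompactSupport.comp_homeomorph (Homeomorph.addRight (-a))
    exact h
  tsupport_subset' := by simp

theorem shiftTest_continuous (a : ℝ) (F : Test →L[ℝ] ℝ) (K : TopologicalSpace.Compacts ℝ)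
    (hK : (K : Set ℝ) ⊆ (⊤ : TopologicalSpace.Opens ℝ)) :
    Continuous ((fun t : Test => F (shiftTest a t)) ∘ TestFunction.ofSupportedIn hK) := by
  let K' : TopologicalSpace.Compacts ℝ := K.map (fun x => x + a) (by fun_prop)
  let T : 𝓓_{K}(ℝ, ℝ) →L[ℝ] 𝓓_{K'}(ℝ, ℝ) :=
    ContDiffMapSupportedIn.mkCLM ℝ (fun f x => f (x - a)) (fun f g x => rfl) (fun c f x => rfl)
      (fun f => f.contDiff.comp (contDiff_id.sub contDiff_const))
      (fun f x hx => by
        apply f.zero_on_compl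
        intro h
        exact hx ⟨x - a, h, by simp⟩)
      (fun i hi => ⟨{i}, 1, zero_le_one, fun f x _ => by
        rw [iteratedFDeriv_comp_sub, one_mul, Finset.sup_singleton]
        exact ContDiffMapSupportedIn.norm_iteratedFDeriv_apply_le_seminorm ℝ hi⟩)
  have hK' : (K' : Set ℝ) ⊆ (⊤ : TopologicalSpace.Opens ℝ) := by simp
  exact F.continuous.comp ((TestFunction.continuous_ofSupportedIn hK').comp T.continuous)

/-- The translated distribution `G(x + a)`, i.e. `⟨G(x + a), t(x)⟩ = ⟨G(x), t(x - a)⟩`. -/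
noncomputable def translate (a : ℝ) (G : Dist) : Dist :=
  (TestFunction.mkCLM ℝ (fun t : Test => G (shiftTest a t))
    (fun f g => G.map_add (shiftTest a f) (shiftTest a g))
    (fun c f => G.map_smul c (shiftTest a f))
    (shiftTest_continuous a G) : Test →L[ℝ] ℝ)

theorem translate_apply (a : ℝ) (G : Dist) (t : Test) :
    translate a G t = G (shiftTest a t) := rfl

/-- On the open set `U` the distribution `F` is (the regular distribution of) the smooth function
`φ : U → ℝ`; the values of `φ` outside `U` are irrelevant. -/
def EqSmoothOn (F : Dist) (φ : ℝ → ℝ) (U : Set ℝ) : Prop :=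
  ContDiffOn ℝ ∞ φ U ∧ ∀ t : Test, tsupport t ⊆ U → F t = ∫ x, φ x * t x

/-- The singular support: the points with no open neighbourhood on which `F` is smooth. -/
def singSupp (F : Dist) : Set ℝ :=
  {x | ¬ ∃ U : Set ℝ, IsOpen U ∧ x ∈ U ∧ ∃ φ : ℝ → ℝ, EqSmoothOn F φ U}

/-- The product `φ t` of a smooth function `φ` on the open set `U` with a test function supported
in `U`. -/
noncomputable def mulTest {φ : ℝ → ℝ} {U : Set ℝ} (hU : IsOpen U) (hφ : ContDiffOn ℝ ∞ φ U) (t : Test)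
    (ht : tsupport t ⊆ U) : Test where
  toFun x := φ x * t x
  contDiff' := by
    rw [contDiff_iff_contDiffAt]
    intro x
    by_cases hx : x ∈ tsupport t
    · exact (hφ.contDiffAt (hU.mem_nhds (ht hx))).mul t.contDiff.contDiffAt
    · have h0 : (fun y => φ y * t y) =ᶠ[𝓝 x] fun _ => 0 := by
        filter_upwards [(isClosed_tsupport t).isOpen_compl.mem_nhds hx] with y hy
        rw [image_eq_zero_of_notMem_tsupport hy, mul_zero]
      exact contDiffAt_const.congr_of_eventuallyEq h0
  hasCompactSupport' := t.hasCompactSupport.mul_left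
  tsupport_subset' := by simp

/-- On the open set `U`, the distribution `P` is the dual product `φ G`, `⟨φ G, t⟩ = ⟨G, φ t⟩`, of
the smooth function `φ` on `U` by the restriction of `G` to `U`. -/
def EqDualProductOn (P : Dist) (φ : ℝ → ℝ) (G : Dist) (U : Set ℝ) : Prop :=
  ∃ (hU : IsOpen U) (hφ : ContDiffOn ℝ ∞ φ U),
    ∀ (t : Test) (ht : tsupport t ⊆ U), P t = G (mulTest hU hφ t ht)

/-- `P` is the Hörmander product `F · G` of two distributions with finite and disjoint singular
supports: there is a finite open covering of `ℝ` on each member `U` of which `F` or `G` is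
smooth, and `P` restricted to `U` is the dual product of the smooth factor by the other one. -/
def IsHormanderProduct (F G P : Dist) : Prop :=
  (singSupp F).Finite ∧ (singSupp G).Finite ∧ Disjoint (singSupp F) (singSupp G) ∧
  ∃ 𝒰 : Set (Set ℝ), 𝒰.Finite ∧ ⋃₀ 𝒰 = univ ∧ ∀ U ∈ 𝒰, IsOpen U ∧
    ((∃ φ : ℝ → ℝ, EqSmoothOn F φ U ∧ EqDualProductOn P φ G U) ∨
     (∃ φ : ℝ → ℝ, EqSmoothOn G φ U ∧ EqDualProductOn P φ F U))

/-- `P = F * G`, where `F * G = lim_{ε ↓ 0} F(x) · G(x + ε)` in the sense of distributions and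
`·` is the Hörmander product (which has to exist for all sufficiently small `ε > 0`). -/
def IsStarProduct (F G P : Dist) : Prop :=
  ∃ H : ℝ → Dist, (∀ᶠ ε in 𝓝[>] (0 : ℝ), IsHormanderProduct F (translate ε G) (H ε)) ∧
    ∀ t : Test, Tendsto (fun ε => H ε t) (𝓝[>] (0 : ℝ)) (𝓝 (P t))

/-- The Dirac measure at `x`, as a distribution. -/
noncomputable def dirac (x : ℝ) : Dist := Distribution.delta x

/-- `F = f + ∑_{x ∈ I} Δ x`, where `f` is piecewise smooth, `I` is the (finite) support of the
finitely supported family `Δ`, and each `Δ x` is a linear combination of derivatives of the Dirac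
measure at `x`. So `I` is the support of the singular part `∑_{x ∈ I} Δ x`. -/
def IsDecomposition (F : Dist) (f : ℝ → ℝ) (Δ : ℝ →₀ Dist) : Prop :=
  PiecewiseSmooth f ∧
  (∀ x, Δ x ∈ Submodule.span ℝ (range fun j : ℕ => Dx^[j] (dirac x))) ∧
  F = regular f + ∑ x ∈ Δ.support, Δ x

open Classical in
/-- `P = F *_M G`: for a decomposition `F = f + ∑_{x ∈ I_F} Δ^F_x`, `G = g + ∑_{y ∈ I_G} Δ^G_y`,
`F *_M G = f g + ∑_{y ∈ I_G ∩ M} f * Δ^G_y + ∑_{x ∈ I_F ∩ M} Δ^F_x * g`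
`  + ∑_{y ∈ I_G \ M} Δ^G_y * f + ∑_{x ∈ I_F \ M} g * Δ^F_x`.
Here `S₁ y`, `S₂ x`, `S₃ y`, `S₄ x` are the four kinds of summands. -/
def IsProductM (M : Set ℝ) (F G P : Dist) : Prop :=
  ∃ (f g : ℝ → ℝ) (ΔF ΔG : ℝ →₀ Dist) (S₁ S₂ S₃ S₄ : ℝ → Dist),
    IsDecomposition F f ΔF ∧ IsDecomposition G g ΔG ∧
    (∀ y ∈ ΔG.support, y ∈ M → IsStarProduct (regular f) (ΔG y) (S₁ y)) ∧
    (∀ x ∈ ΔF.support, x ∈ M → IsStarProduct (ΔF x) (regular g) (S₂ x)) ∧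
    (∀ y ∈ ΔG.support, y ∉ M → IsStarProduct (ΔG y) (regular f) (S₃ y)) ∧
    (∀ x ∈ ΔF.support, x ∉ M → IsStarProduct (regular g) (ΔF x) (S₄ x)) ∧
    P = regular (fun x => f x * g x)
      + ∑ y ∈ ΔG.support with y ∈ M, S₁ y + ∑ x ∈ ΔF.support with x ∈ M, S₂ x
      + ∑ y ∈ ΔG.support with y ∉ M, S₃ y + ∑ x ∈ ΔF.support with x ∉ M, S₄ x

end DistAlg

/-! Everything is decided by how the Heaviside function H with jump at a multiplies δ, the Dirac
measure at a.

Multiplication by a smooth φ, on either side, has to be the dual product. (A4) gives this for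
continuous factors, and the Leibniz rule in the form φ·DF = D(φF) − φ'F carries it from F to DF
(`smooth_mul_apply`). This reaches all of `𝒜`, which is spanned by smooth functions, smooth
functions cut off at a point, and derivatives of Dirac measures (`mem_span_generators`). The
spanning rests on Borel's lemma: the jumps of a piecewise smooth function and of all its derivatives
at a point are removed by subtracting one truncated smooth function.

Write X = x − a. Differentiating the square of the continuous function XH gives X(HH) = XH. Only
multiples of δ are annihilated by X, so HH = H + cδ, Hδ = βδ and δH = αδ. Differentiating the first
relation gives (α + β)δ = δ + cδ', hence c = 0 and α + β = 1, and associativity gives β² = β. So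
either Hδ = 0 and δH = δ, or Hδ = δ and δH = 0 (`heaviside_dichotomy`). The set M consists of the
points a of the first kind.

This binary choice determines the whole product. H acts on the left on all distributions supported
at a as 0 or as the identity (`heaviside_mul_point`), and on the right in the opposite way;
inserting H between two such distributions shows that their product vanishes (`point_mul_point`).
Near a, a piecewise smooth function is ψl + (ψr − ψl)H, so its product with a distribution supported
at a sees only the left or only the right germ (`regular_mul_point`). Two piecewise smooth functions
multiply pointwise because Heaviside functions multiply as indicators do (`regular_mul_regular`).

On the other side, G(x + ε) moves a support point y to y − ε: f * Δ uses the left germ of f, and Δ *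
f the right germ. Matching germs gives the terms of *_M (`isStarProduct_iff`). The final equivalence
of graphs contains the existence of the limits as well as the independence of the chosen
decompositions. -/

namespace DistAlg

/-! ### Smooth extension, the lemmas of Borel and Hadamard, splitting off jumps -/

/-- If all derivatives of a function that is smooth on a punctured open set have limits at the
puncture, then the function extends smoothly. -/
theorem contDiffOn_update_of_tendsto {s : Set ℝ} (hs : IsOpen s) {a : ℝ} (ha : a ∈ s)
    {u : ℝ → ℝ} {l : ℕ → ℝ} (hu : ContDiffOn ℝ ∞ u (s \ {a}))
    (hl : ∀ n, Tendsto (iteratedDeriv n u) (𝓝[≠] a) (𝓝 (l n))) :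
    ContDiffOn ℝ ∞ (Function.update u a (l 0)) s := by
  have hopen : IsOpen (s \ {a}) := hs.sdiff isClosed_singleton
  rw [contDiffOn_infty]
  intro n
  induction n generalizing u l with
  | zero =>
    simp only [Nat.cast_zero, contDiffOn_zero]
    intro x hx
    by_cases hxa : x = a
    · subst hxa
      exact (continuousAt_update_same.2 (by simpa using hl 0)).continuousWithinAt
    · exact ((continuousAt_update_of_ne hxa).2
        (hu.continuousOn.continuousAt (hopen.mem_nhds ⟨hx, hxa⟩))).continuousWithinAt
  | succ n ih =>
    have hoff : ∀ x, x ≠ a → Function.update u a (l 0) =ᶠ[𝓝 x] u := fun x hx => by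
      filter_upwards [isOpen_ne.mem_nhds hx] with y hy
      exact Function.update_of_ne hy _ _
    have hdoff : ∀ x, x ≠ a → deriv (Function.update u a (l 0)) x = deriv u x :=
      fun x hx => (hoff x hx).deriv_eq
    have hdiff : ∀ x ∈ s, x ≠ a → DifferentiableAt ℝ (Function.update u a (l 0)) x :=
      fun x hx hxa => ((hoff x hxa).differentiableAt_iff).2
        ((hu.contDiffAt (hopen.mem_nhds ⟨hx, hxa⟩)).differentiableAt (by simp))
    have hcont : ContinuousAt (Function.update u a (l 0)) a :=
      continuousAt_update_same.2 (by simpa using hl 0)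
    have hlim : Tendsto (deriv (Function.update u a (l 0))) (𝓝[≠] a) (𝓝 (l 1)) := by
      have h1 := hl 1
      rw [iteratedDeriv_one] at h1
      refine h1.congr' ?_
      filter_upwards [self_mem_nhdsWithin] with y hy
      exact (hdoff y hy).symm
    -- A continuous function whose derivative has a limit at a from one side has that limit as
    -- one-sided derivative; here both sides give `l 1`. The derivative of the extension is thus the
    -- extension of the derivative, and the induction continues with the shifted sequence of limits.
    have hder : HasDerivAt (Function.update u a (l 0)) (l 1) a := by
      have hsr : s ∩ Ioi a ∈ 𝓝[>] a := inter_mem (mem_nhdsWithin_of_mem_nhds (hs.mem_nhds ha)) self_mem_nhdsWithin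
      have hsl : s ∩ Iio a ∈ 𝓝[<] a := inter_mem (mem_nhdsWithin_of_mem_nhds (hs.mem_nhds ha)) self_mem_nhdsWithin
      have A := hasDerivWithinAt_Ici_of_tendsto_deriv (s := s ∩ Ioi a)
        (fun x hx => (hdiff x hx.1 (ne_of_gt hx.2)).differentiableWithinAt)
        hcont.continuousWithinAt hsr (hlim.mono_left (nhdsWithin_mono _ fun x hx => ne_of_gt hx))
      have B := hasDerivWithinAt_Iic_of_tendsto_deriv (s := s ∩ Iio a)
        (fun x hx => (hdiff x hx.1 (ne_of_lt hx.2)).differentiableWithinAt)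
        hcont.continuousWithinAt hsl (hlim.mono_left (nhdsWithin_mono _ fun x hx => ne_of_lt hx))
      simpa using B.union A
    have hEq : deriv (Function.update u a (l 0)) = Function.update (deriv u) a (l 1) := by
      funext x
      by_cases hxa : x = a
      · subst hxa; simp [hder.deriv]
      · rw [hdoff x hxa, Function.update_of_ne hxa]
    push_cast
    rw [contDiffOn_succ_iff_deriv_of_isOpen hs]
    refine ⟨fun x hx => ?_, by simp, ?_⟩
    · by_cases hxa : x = a
      · subst hxa; exact hder.differentiableAt.differentiableWithinAt
      · exact (hdiff x hx hxa).differentiableWithinAt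
    · rw [hEq]
      refine ih (l := fun k => l (k + 1)) ((contDiffOn_infty_iff_deriv_of_isOpen hopen).1 hu).2 ?_
      intro k
      simpa only [← iteratedDeriv_succ'] using hl (k + 1)

/-- One term of Borel's series. With g = xⁿ times a bump, the rescaling εⁿ g(x/ε) keeps the n-th
derivative at 0, while its derivatives of order k < n gain a factor εⁿ⁻ᵏ ≤ ε and become uniformly
small. -/
theorem exists_contDiff_single_jet (n : ℕ) (c : ℝ) {η : ℝ} (hη : 0 < η) :
    ∃ u : ℝ → ℝ, ContDiff ℝ ∞ u ∧ HasCompactSupport u ∧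
      (∀ k < n, ∀ x, ‖iteratedDeriv k u x‖ ≤ η) ∧
      ∀ k, iteratedDeriv k u 0 = if k = n then c else 0 := by
  let χ : ContDiffBump (0 : ℝ) := default
  let g : ℝ → ℝ := fun x => x ^ n * χ x
  have hg : ContDiff ℝ ∞ g := (contDiff_id.pow n).mul χ.contDiff
  have hgc : HasCompactSupport g := χ.hasCompactSupport.mul_left
  have hg0 : ∀ k, iteratedDeriv k g 0 = if k = n then (n.factorial : ℝ) else 0 := by
    intro k
    have : g =ᶠ[𝓝 0] fun x => x ^ n := by
      filter_upwards [χ.eventuallyEq_one] with x hx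
      simp [g, hx]
    rw [this.iteratedDeriv_eq k, iteratedDeriv_fun_pow_zero]
    split_ifs <;> simp
  have hbd : ∃ B : ℝ, 0 ≤ B ∧ ∀ k < n, ∀ x, ‖iteratedDeriv k g x‖ ≤ B := by
    have hk : ∀ k : ℕ, ∃ B : ℝ, 0 ≤ B ∧ ∀ x, ‖iteratedDeriv k g x‖ ≤ B := by
      intro k
      have hcs : HasCompactSupport (iteratedDeriv k g) := by
        induction k with
        | zero => simpa using hgc
        | succ k ih => rw [iteratedDeriv_succ]; exact ih.deriv
      obtain ⟨B, hB⟩ := (hg.continuous_iteratedDeriv k (by exact_mod_cast le_top)).bounded_above_of_compact_support hcs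
      exact ⟨B, (norm_nonneg _).trans (hB 0), hB⟩
    choose B hB0 hB using hk
    refine ⟨∑ k ∈ Finset.range n, B k, Finset.sum_nonneg fun k _ => hB0 k, fun k hk x => ?_⟩
    exact (hB k x).trans (Finset.single_le_sum (fun k _ => hB0 k) (Finset.mem_range.2 hk))
  obtain ⟨B, hB0, hB⟩ := hbd
  set d : ℝ := c / n.factorial with hd
  -- The bound 1 gives εⁿ⁻ᵏ ≤ ε for k < n; the summand `+ 1` keeps the denominator positive when `d`
  -- or `B` vanishes.
  set ε : ℝ := min 1 (η / (|d| * B + 1)) with hε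
  have hε0 : 0 < ε := by positivity
  have hε1 : ε ≤ 1 := min_le_left _ _
  have hεη : |d| * B * ε ≤ η := by
    have h1 : ε * (|d| * B + 1) ≤ η := by
      have := min_le_right 1 (η / (|d| * B + 1))
      rwa [← hε, le_div_iff₀ (by positivity)] at this
    nlinarith
  have hgε : ContDiff ℝ ∞ (fun x => g (ε⁻¹ * x)) := hg.comp (contDiff_const.mul contDiff_id)
  have hder : ∀ k x, iteratedDeriv k (fun x => d * ε ^ n * g (ε⁻¹ * x)) x
      = d * ε ^ n * ((ε⁻¹) ^ k * iteratedDeriv k g (ε⁻¹ * x)) := by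
    intro k x
    rw [iteratedDeriv_const_mul_field,
      iteratedDeriv_comp_const_mul (hg.of_le (by exact_mod_cast le_top))]
  refine ⟨fun x => d * ε ^ n * g (ε⁻¹ * x), contDiff_const.mul hgε, ?_, ?_, ?_⟩
  · have := hgc.comp_smul (c := ε⁻¹) (inv_ne_zero hε0.ne')
    exact HasCompactSupport.mul_left this
  · intro k hk x
    rw [hder]
    have hεk : ε ^ n * ε⁻¹ ^ k ≤ ε := by
      obtain ⟨m, rfl⟩ : ∃ m, n = k + m + 1 := ⟨n - k - 1, by omega⟩
      have : ε ^ (k + m + 1) * ε⁻¹ ^ k = ε ^ m * ε := by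
        rw [inv_pow, pow_succ, pow_add]; field_simp
      rw [this]
      exact mul_le_of_le_one_left hε0.le (pow_le_one₀ hε0.le hε1)
    have hpos : 0 ≤ ε ^ n * ε⁻¹ ^ k := by positivity
    calc ‖d * ε ^ n * (ε⁻¹ ^ k * iteratedDeriv k g (ε⁻¹ * x))‖
        = |d| * (ε ^ n * ε⁻¹ ^ k) * ‖iteratedDeriv k g (ε⁻¹ * x)‖ := by
          rw [show d * ε ^ n * (ε⁻¹ ^ k * iteratedDeriv k g (ε⁻¹ * x))
            = d * (ε ^ n * ε⁻¹ ^ k) * iteratedDeriv k g (ε⁻¹ * x) by ring, norm_mul, norm_mul,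
            Real.norm_of_nonneg hpos, Real.norm_eq_abs d]
      _ ≤ |d| * ε * B := by gcongr; exact hB k hk _
      _ ≤ η := by linarith
  · intro k
    rw [hder, mul_zero, hg0]
    split_ifs with h
    · subst h
      have hε' : ε ^ k * ε⁻¹ ^ k = 1 := by rw [← mul_pow, mul_inv_cancel₀ hε0.ne', one_pow]
      rw [hd]
      calc c / k.factorial * ε ^ k * (ε⁻¹ ^ k * k.factorial)
          = c * (ε ^ k * ε⁻¹ ^ k) := by field_simp
        _ = c := by rw [hε', mul_one]
    · simp

/-- **Borel's lemma**. -/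
theorem exists_contDiff_iteratedDeriv_eq (a : ℝ) (c : ℕ → ℝ) :
    ∃ φ : ℝ → ℝ, ContDiff ℝ ∞ φ ∧ ∀ n, iteratedDeriv n φ a = c n := by
  choose u hu hucs hub hu0 using fun n : ℕ =>
    exists_contDiff_single_jet n (c n) (η := (1 / 2) ^ n) (by positivity)
  have hk : ∀ n k : ℕ, ∃ B : ℝ, ∀ x, ‖iteratedDeriv k (u n) x‖ ≤ B := by
    intro n k
    have hcs : HasCompactSupport (iteratedDeriv k (u n)) := by
      induction k with
      | zero => simpa using hucs n
      | succ k ih => rw [iteratedDeriv_succ]; exact ih.deriv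
    exact ((hu n).continuous_iteratedDeriv k (by exact_mod_cast le_top)).bounded_above_of_compact_support hcs
  choose B hB using hk
  -- Majorant for the k-th derivatives: geometric for n > k, with a crude bound on the finitely many
  -- remaining terms.
  let v : ℕ → ℕ → ℝ := fun k n => if k < n then (1 / 2) ^ n else B n k
  have hv : ∀ k, Summable (v k) := by
    intro k
    refine (summable_congr_cofinite ?_).2 (summable_geometric_two)
    rw [Nat.cofinite_eq_atTop]
    filter_upwards [eventually_gt_atTop k] with n hn
    simp [v, hn]
  have hle : ∀ (k n : ℕ) (x : ℝ), ‖iteratedFDeriv ℝ k (u n) x‖ ≤ v k n := by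
    intro k n x
    rw [norm_iteratedFDeriv_eq_norm_iteratedDeriv]
    by_cases h : k < n
    · simpa only [v, h, if_true] using hub n k h x
    · simpa only [v, h, if_false] using hB n k x
  have hcd : ContDiff ℝ ∞ fun x => ∑' n, u n x :=
    contDiff_tsum (N := ⊤) hu (fun k _ => hv k) (fun k n x _ => hle k n x)
  refine ⟨fun x => ∑' n, u n (x - a), hcd.comp (contDiff_id.sub contDiff_const), fun k => ?_⟩
  have h1 := congrFun (iteratedDeriv_comp_sub_const k (fun x => ∑' n, u n x) a) a
  refine h1.trans ?_
  rw [sub_self, iteratedDeriv_eq_iteratedFDeriv,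
    iteratedFDeriv_tsum_apply (N := ⊤) hu (fun k _ => hv k) (fun k n x _ => hle k n x) le_top]
  have hsum : Summable fun n => iteratedFDeriv ℝ k (u n) 0 :=
    Summable.of_norm_bounded (hv k) fun n => hle k n 0
  rw [ContinuousMultilinearMap.tsum_eval hsum]
  simp_rw [← iteratedDeriv_eq_iteratedFDeriv, hu0]
  simp

theorem indicator_Ioi_eventuallyEq (ψ : ℝ → ℝ) {a x : ℝ} (h : a < x) :
    (Ioi a).indicator ψ =ᶠ[𝓝 x] ψ := by
  filter_upwards [lt_mem_nhds h] with y hy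
  exact indicator_of_mem hy _

theorem indicator_Ioi_eventuallyEq_zero (ψ : ℝ → ℝ) {a x : ℝ} (h : x < a) :
    (Ioi a).indicator ψ =ᶠ[𝓝 x] fun _ => 0 := by
  filter_upwards [gt_mem_nhds h] with y hy
  exact indicator_of_notMem (by simpa using hy.le) _

theorem contDiffAt_indicator_Ioi {ψ : ℝ → ℝ} (hψ : ContDiff ℝ ∞ ψ) {a x : ℝ} (h : x ≠ a) :
    ContDiffAt ℝ ∞ ((Ioi a).indicator ψ) x := by
  rcases h.lt_or_gt with h | h
  · exact contDiffAt_const.congr_of_eventuallyEq (indicator_Ioi_eventuallyEq_zero ψ h)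
  · exact hψ.contDiffAt.congr_of_eventuallyEq (indicator_Ioi_eventuallyEq ψ h)

theorem continuousAt_iteratedDeriv {f : ℝ → ℝ} {x : ℝ} (hf : ContDiffAt ℝ ∞ f x) (n : ℕ) :
    ContinuousAt (iteratedDeriv n f) x := by
  have h : ContDiffAt ℝ 0 (iteratedFDeriv ℝ n f) x := hf.iteratedFDeriv_right (by exact_mod_cast le_top)
  rw [iteratedDeriv_eq_equiv_comp]
  exact (LinearIsometryEquiv.continuous _).continuousAt.comp h.continuousAt

theorem tendsto_iteratedDeriv_indicator_Ioi {ψ : ℝ → ℝ} (hψ : ContDiff ℝ ∞ ψ) (a : ℝ) (n : ℕ) :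
    Tendsto (iteratedDeriv n ((Ioi a).indicator ψ)) (𝓝[<] a) (𝓝 0) ∧
    Tendsto (iteratedDeriv n ((Ioi a).indicator ψ)) (𝓝[>] a) (𝓝 (iteratedDeriv n ψ a)) := by
  constructor
  · refine tendsto_const_nhds.congr' ?_
    filter_upwards [self_mem_nhdsWithin] with y hy
    rw [(indicator_Ioi_eventuallyEq_zero ψ hy).iteratedDeriv_eq n]
    simp
  · have h := (continuousAt_iteratedDeriv hψ.contDiffAt n (x := a)).mono_left
      (nhdsWithin_le_nhds (s := Ioi a))
    refine h.congr' ?_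
    filter_upwards [self_mem_nhdsWithin] with y hy
    rw [(indicator_Ioi_eventuallyEq ψ hy).iteratedDeriv_eq n]

/-- A piecewise smooth function is a sum of a smooth function and of smooth functions cut off at
the singular points. -/
theorem exists_eq_add_sum_indicator (I : Finset ℝ) {f : ℝ → ℝ}
    (hf : ContDiffOn ℝ ∞ f (I : Set ℝ)ᶜ)
    (hlim : ∀ x₀ ∈ I, ∀ n : ℕ,
      (∃ l : ℝ, Tendsto (iteratedDeriv n f) (𝓝[<] x₀) (𝓝 l)) ∧
      (∃ r : ℝ, Tendsto (iteratedDeriv n f) (𝓝[>] x₀) (𝓝 r))) :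
    ∃ (φ₀ : ℝ → ℝ) (φ : ℝ → ℝ → ℝ), ContDiff ℝ ∞ φ₀ ∧ (∀ a, ContDiff ℝ ∞ (φ a)) ∧
      ∀ x ∉ I, f x = φ₀ x + ∑ a ∈ I, (Ioi a).indicator (φ a) x := by
  classical
  induction I using Finset.induction_on generalizing f with
  | empty =>
    refine ⟨f, fun _ _ => 0, by simpa [contDiffOn_univ] using hf, fun _ => contDiff_const, by simp⟩
  | insert a I ha ih =>
    choose L R using hlim a (Finset.mem_insert_self a I)
    choose l hl using L
    choose r hr using R
    -- ψ has as jet at a the jumps of f and of all its derivatives, so subtracting ψ cut off at a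
    -- leaves two-sided limits at a. The difference then extends smoothly across a, and one singular
    -- point has been removed.
    obtain ⟨ψ, hψ, hψa⟩ := exists_contDiff_iteratedDeriv_eq a (fun n => r n - l n)
    let w : ℝ → ℝ := (Ioi a).indicator ψ
    let u : ℝ → ℝ := f - w
    have hopen : IsOpen ((insert a I : Finset ℝ) : Set ℝ)ᶜ :=
      (Finset.finite_toSet _).isClosed.isOpen_compl
    have hfat : ∀ y ∉ insert a I, ContDiffAt ℝ ∞ f y := fun y hy =>
      hf.contDiffAt (hopen.mem_nhds (by exact_mod_cast hy))
    have hwat : ∀ y ≠ a, ContDiffAt ℝ ∞ w y := fun y hy => contDiffAt_indicator_Ioi hψ hy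
    have hu_der : ∀ y ∉ insert a I, ∀ n, iteratedDeriv n u y
        = iteratedDeriv n f y - iteratedDeriv n w y := fun y hy n =>
      iteratedDeriv_sub ((hfat y hy).of_le (by exact_mod_cast le_top))
        ((hwat y (by rintro rfl; simp at hy)).of_le (by exact_mod_cast le_top))
    have hev : ∀ x, ∀ᶠ y in 𝓝[≠] x, y ∉ insert a I := by
      intro x
      have h1 : (((insert a I : Finset ℝ) : Set ℝ) \ {x})ᶜ ∈ 𝓝 x :=
        ((Finset.finite_toSet _).subset sdiff_subset).isClosed.isOpen_compl.mem_nhds (by simp)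
      filter_upwards [mem_nhdsWithin_of_mem_nhds h1, self_mem_nhdsWithin] with y hy hyx hyI
      exact hy ⟨by exact_mod_cast hyI, hyx⟩
    have hevl : ∀ x, ∀ᶠ y in 𝓝[<] x, y ∉ insert a I := fun x =>
      (hev x).filter_mono (nhdsWithin_mono _ fun y hy => ne_of_lt hy)
    have hevr : ∀ x, ∀ᶠ y in 𝓝[>] x, y ∉ insert a I := fun x =>
      (hev x).filter_mono (nhdsWithin_mono _ fun y hy => ne_of_gt hy)
    have hul : ∀ n, Tendsto (iteratedDeriv n u) (𝓝[≠] a) (𝓝 (l n)) := by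
      intro n
      obtain ⟨h1, h2⟩ := tendsto_iteratedDeriv_indicator_Ioi hψ a n
      rw [← Iio_union_Ioi, nhdsWithin_union]
      refine Tendsto.sup ?_ ?_
      · have := (hl n).sub h1
        rw [sub_zero] at this
        refine this.congr' ?_
        filter_upwards [hevl a] with y hy
        exact (hu_der y hy n).symm
      · have := (hr n).sub h2
        rw [hψa, sub_sub_cancel] at this
        refine this.congr' ?_
        filter_upwards [hevr a] with y hy
        exact (hu_der y hy n).symm
    have hcompl : (I : Set ℝ)ᶜ \ {a} = ((insert a I : Finset ℝ) : Set ℝ)ᶜ := by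
      ext y; simp; tauto
    have hu' : ContDiffOn ℝ ∞ (Function.update u a (l 0)) (I : Set ℝ)ᶜ := by
      refine contDiffOn_update_of_tendsto (Finset.finite_toSet _).isClosed.isOpen_compl
        (by simpa using ha) ?_ hul
      rw [hcompl]
      intro y hy
      have hy' : y ∉ insert a I := by exact_mod_cast hy
      exact ((hfat y hy').sub (hwat y (by rintro rfl; simp at hy'))).contDiffWithinAt
    have hupd : ∀ n, ∀ y ≠ a, iteratedDeriv n (Function.update u a (l 0)) y
        = iteratedDeriv n u y := by
      intro n y hy
      refine Filter.EventuallyEq.iteratedDeriv_eq n ?_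
      filter_upwards [isOpen_ne.mem_nhds hy] with z hz
      exact Function.update_of_ne hz _ _
    obtain ⟨φ₀, φ, hφ₀, hφ, heq⟩ := ih hu' (by
      intro x₀ hx₀ n
      have hne : x₀ ≠ a := by rintro rfl; exact ha hx₀
      have hw := continuousAt_iteratedDeriv (hwat x₀ hne) n
      obtain ⟨⟨l', hl'⟩, r', hr'⟩ := hlim x₀ (Finset.mem_insert_of_mem hx₀) n
      refine ⟨⟨_, (hl'.sub (hw.mono_left nhdsWithin_le_nhds)).congr' ?_⟩,
        ⟨_, (hr'.sub (hw.mono_left nhdsWithin_le_nhds)).congr' ?_⟩⟩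
      · filter_upwards [hevl x₀] with y hy
        rw [hupd n y (by rintro rfl; simp at hy), hu_der y hy]
      · filter_upwards [hevr x₀] with y hy
        rw [hupd n y (by rintro rfl; simp at hy), hu_der y hy])
    refine ⟨φ₀, Function.update φ a ψ, hφ₀, fun b => ?_, fun x hx => ?_⟩
    · by_cases hb : b = a
      · subst hb; simpa using hψ
      · simpa [Function.update_of_ne hb] using hφ b
    · simp only [Finset.mem_insert, not_or] at hx
      have h1 := heq x hx.2
      rw [Function.update_of_ne hx.1] at h1
      rw [Finset.sum_insert ha, Function.update_self,
        Finset.sum_congr rfl (g := fun b => (Ioi b).indicator (φ b) x) (fun b hb => by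
          rw [Function.update_of_ne (by rintro rfl; exact ha hb)])]
      have h2 : u x = f x - (Ioi a).indicator ψ x := rfl
      linarith

/-- Differentiation under the integral brings down one factor θ. Allowing every power θᵏ makes this
family of integrals closed under differentiation, which gives smoothness by induction on the order.
-/
theorem hasDerivAt_integral_pow_mul {φ : ℝ → ℝ} (hφ : ContDiff ℝ ∞ φ) (a : ℝ) (k : ℕ) (x : ℝ) :
    HasDerivAt (fun x => ∫ θ in (0 : ℝ)..1, θ ^ k * φ (a + θ * (x - a)))
      (∫ θ in (0 : ℝ)..1, θ ^ (k + 1) * deriv φ (a + θ * (x - a))) x := by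
  have hφ' : Continuous (deriv φ) := hφ.continuous_deriv (by simp)
  obtain ⟨B, hB⟩ : ∃ B, ∀ p ∈ Icc (0 : ℝ) 1 ×ˢ Metric.closedBall x 1,
      ‖p.1 ^ (k + 1) * deriv φ (a + p.1 * (p.2 - a))‖ ≤ B :=
    (isCompact_Icc.prod (isCompact_closedBall x 1)).exists_bound_of_continuousOn
      (f := fun p : ℝ × ℝ => p.1 ^ (k + 1) * deriv φ (a + p.1 * (p.2 - a)))
      (by fun_prop)
  have hc : Continuous φ := hφ.continuous
  refine (intervalIntegral.hasDerivAt_integral_of_dominated_loc_of_deriv_le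
    (F := fun y θ => θ ^ k * φ (a + θ * (y - a)))
    (F' := fun y θ => θ ^ (k + 1) * deriv φ (a + θ * (y - a)))
    (s := Metric.ball x 1) (bound := fun _ => B)
    (Metric.ball_mem_nhds x one_pos) ?_ ?_ ?_ ?_ ?_ ?_).2
  · exact Eventually.of_forall fun y =>
      (by fun_prop : Continuous fun θ => θ ^ k * φ (a + θ * (y - a))).aestronglyMeasurable
  · exact (by fun_prop : Continuous fun θ => θ ^ k * φ (a + θ * (x - a))).intervalIntegrable _ _
  · exact (by fun_prop : Continuous fun θ =>
      θ ^ (k + 1) * deriv φ (a + θ * (x - a))).aestronglyMeasurable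
  · refine Eventually.of_forall fun θ hθ y hy => ?_
    rw [uIoc_of_le zero_le_one] at hθ
    exact hB (θ, y) ⟨⟨hθ.1.le, hθ.2⟩, Metric.ball_subset_closedBall hy⟩
  · exact intervalIntegrable_const
  · refine Eventually.of_forall fun θ hθ y hy => ?_
    have h1 : HasDerivAt (fun y => a + θ * (y - a)) θ y := by
      simpa using (((hasDerivAt_id y).sub_const a).const_mul θ).const_add a
    have h2 : HasDerivAt φ (deriv φ (a + θ * (y - a))) (a + θ * (y - a)) :=
      (hφ.differentiable (by simp) _).hasDerivAt
    exact ((h2.comp y h1).const_mul (θ ^ k)).congr_deriv (by ring)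

/-- **Hadamard's lemma** in dimension one. -/
theorem exists_contDiff_eq_mul {f : ℝ → ℝ} (hf : ContDiff ℝ ∞ f) {a : ℝ} (ha : f a = 0) :
    ∃ s : ℝ → ℝ, ContDiff ℝ ∞ s ∧ ∀ x, f x = (x - a) * s x := by
  have key : ∀ (n k : ℕ) (φ : ℝ → ℝ), ContDiff ℝ ∞ φ →
      ContDiff ℝ n (fun x => ∫ θ in (0 : ℝ)..1, θ ^ k * φ (a + θ * (x - a))) := by
    intro n
    induction n with
    | zero =>
      intro k φ hφ
      exact contDiff_zero.2 (continuous_iff_continuousAt.2 fun x =>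
        (hasDerivAt_integral_pow_mul hφ a k x).continuousAt)
    | succ n ih =>
      intro k φ hφ
      push_cast
      rw [contDiff_succ_iff_deriv]
      refine ⟨fun x => (hasDerivAt_integral_pow_mul hφ a k x).differentiableAt, by simp, ?_⟩
      rw [funext fun x => (hasDerivAt_integral_pow_mul hφ a k x).deriv]
      exact ih (k + 1) (deriv φ) (contDiff_infty_iff_deriv.1 hφ).2
  -- The quotient comes from integrating the θ-derivative of f(a + θ(x − a)) over [0, 1]; the factor
  -- `θ ^ 0` puts it in the form required by `key`.
  refine ⟨fun x => ∫ θ in (0 : ℝ)..1, θ ^ 0 * deriv f (a + θ * (x - a)),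
    contDiff_infty.2 fun n => key n 0 _ (contDiff_infty_iff_deriv.1 hf).2, fun x => ?_⟩
  have hder : ∀ θ ∈ uIcc (0 : ℝ) 1, HasDerivAt (fun θ => f (a + θ * (x - a)))
      ((x - a) * (θ ^ 0 * deriv f (a + θ * (x - a)))) θ := by
    intro θ _
    have h1 : HasDerivAt (fun θ => a + θ * (x - a)) (x - a) θ := by
      simpa using ((hasDerivAt_id θ).mul_const (x - a)).const_add a
    have h2 : HasDerivAt f (deriv f (a + θ * (x - a))) (a + θ * (x - a)) :=
      (hf.differentiable (by simp) _).hasDerivAt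
    exact (h2.comp θ h1).congr_deriv (by ring)
  have hf' : Continuous (deriv f) := hf.continuous_deriv (by simp)
  have h := intervalIntegral.integral_eq_sub_of_hasDerivAt hder
    ((by fun_prop : Continuous fun θ =>
      (x - a) * (θ ^ 0 * deriv f (a + θ * (x - a)))).intervalIntegrable _ _)
  rw [intervalIntegral.integral_const_mul] at h
  rw [h]
  simp [ha]

/-! ### Evaluation of distributions, test functions, distributions supported at a point -/

theorem add_apply (F G : Dist) (t : Test) : (F + G) t = F t + G t := rfl
theorem smul_apply (c : ℝ) (F : Dist) (t : Test) : (c • F) t = c * F t := rfl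
theorem sum_apply {ι : Type*} (s : Finset ι) (F : ι → Dist) (t : Test) :
    (∑ i ∈ s, F i) t = ∑ i ∈ s, F i t := by
  classical
  induction s using Finset.induction_on with
  | empty => simp
  | insert a s ha ih => rw [Finset.sum_insert ha, Finset.sum_insert ha, add_apply, ih]

theorem dist_ext {F G : Dist} (h : ∀ t : Test, F t = G t) : F = G := DFunLike.ext _ _ h

theorem dirac_apply (a : ℝ) (t : Test) : dirac a t = t a := rfl

/-- The derivative of a test function. -/
noncomputable def derivTest (t : Test) : Test := TestFunction.lineDerivCLM ℝ (1 : ℝ) t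

@[simp] theorem derivTest_apply (t : Test) (x : ℝ) : derivTest t x = deriv t x := by
  simp [derivTest, lineDeriv, deriv_comp_const_add]

theorem Dx_apply_eq (F : Dist) (t : Test) : Dx F t = - F (derivTest t) :=
  Dx_apply F t _ (derivTest_apply t)

/-- The product of a smooth function by a test function. -/
noncomputable def smoothMul {φ : ℝ → ℝ} (hφ : ContDiff ℝ ∞ φ) (t : Test) : Test :=
  mulTest isOpen_univ hφ.contDiffOn t (subset_univ _)

@[simp] theorem smoothMul_apply {φ : ℝ → ℝ} (hφ : ContDiff ℝ ∞ φ) (t : Test) (x : ℝ) :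
    smoothMul hφ t x = φ x * t x := rfl

theorem contDiff_deriv {φ : ℝ → ℝ} (hφ : ContDiff ℝ ∞ φ) : ContDiff ℝ ∞ (deriv φ) :=
  (contDiff_infty_iff_deriv.1 hφ).2

theorem test_contDiff (t : Test) : ContDiff ℝ ∞ t := t.contDiff

theorem test_differentiable (t : Test) : Differentiable ℝ t :=
  (test_contDiff t).differentiable (by simp)

theorem derivTest_smoothMul {φ : ℝ → ℝ} (hφ : ContDiff ℝ ∞ φ) (t : Test) :
    derivTest (smoothMul hφ t) = smoothMul (contDiff_deriv hφ) t + smoothMul hφ (derivTest t) := by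
  ext x
  have : ⇑(smoothMul hφ t) = fun x => φ x * t x := rfl
  rw [derivTest_apply, this]
  have h := deriv_fun_mul (hφ.differentiable (by simp) x) (test_differentiable t x)
  rw [h]
  simp

theorem iterate_Dx_dirac_apply (a : ℝ) (n : ℕ) (t : Test) :
    Dx^[n] (dirac a) t = (-1) ^ n * iteratedDeriv n t a := by
  induction n generalizing t with
  | zero => simp [dirac_apply]
  | succ n ih =>
    rw [Function.iterate_succ_apply', Dx_apply_eq, ih, iteratedDeriv_succ', pow_succ]
    have : ⇑(derivTest t) = deriv t := funext (derivTest_apply t)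
    rw [this]
    ring

/-- A test function equal to `1` near `a`, supported in a given neighbourhood of `a`. -/
theorem exists_test_eq_one {a : ℝ} {s : Set ℝ} (hs : s ∈ 𝓝 a) :
    ∃ χ : Test, tsupport χ ⊆ s ∧ ∀ᶠ x in 𝓝 a, χ x = 1 := by
  obtain ⟨ε, hε, hεs⟩ := Metric.mem_nhds_iff.1 hs
  let b : ContDiffBump a := ⟨ε / 4, ε / 2, by positivity, by linarith⟩
  refine ⟨⟨b, b.contDiff, b.hasCompactSupport, by simp⟩, ?_, b.eventuallyEq_one⟩
  change tsupport b ⊆ s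
  rw [b.tsupport_eq]
  exact (Metric.closedBall_subset_ball (by change ε / 2 < ε; linarith)).trans hεs

/-- The space of distributions supported at `a` (linear combinations of the derivatives of the
Dirac measure). -/
noncomputable abbrev pointDist (a : ℝ) : Submodule ℝ Dist :=
  Submodule.span ℝ (range fun j : ℕ => Dx^[j] (dirac a))

/-- Only finitely many derivatives at a enter, and these depend on the germ of the test function
alone. -/
theorem pointDist_congr {a : ℝ} {G : Dist} (hG : G ∈ pointDist a) {t s : Test}
    (h : (t : ℝ → ℝ) =ᶠ[𝓝 a] s) : G t = G s := by
  induction hG using Submodule.span_induction with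
  | mem F hF =>
    obtain ⟨n, rfl⟩ := hF
    simp only
    rw [iterate_Dx_dirac_apply, iterate_Dx_dirac_apply, h.iteratedDeriv_eq n]
  | zero => rfl
  | add F G _ _ hF hG => rw [add_apply, add_apply, hF, hG]
  | smul c F _ hF => rw [smul_apply, smul_apply, hF]

theorem pointDist_eq_zero {a : ℝ} {G : Dist} (hG : G ∈ pointDist a) {t : Test}
    (h : (t : ℝ → ℝ) =ᶠ[𝓝 a] fun _ => 0) : G t = 0 := by
  rw [pointDist_congr hG (s := 0) h, map_zero]

/-! ### Regular distributions -/

theorem locallyIntegrable_of_contDiff {φ : ℝ → ℝ} (hφ : ContDiff ℝ ∞ φ) : LocallyIntegrable φ :=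
  hφ.continuous.locallyIntegrable

theorem integrable_mul_test {f : ℝ → ℝ} (hf : LocallyIntegrable f) (t : Test) :
    Integrable fun x => f x * t x := by
  have h := hf.integrable_smul_left_of_hasCompactSupport t.continuous t.hasCompactSupport
  simpa [mul_comm] using h

theorem regular_congr {f g : ℝ → ℝ} (hf : LocallyIntegrable f) (h : f =ᵐ[volume] g) :
    regular f = regular g := by
  have hg : LocallyIntegrable g := fun x => by
    obtain ⟨s, hs, hfs⟩ := hf x
    exact ⟨s, hs, hfs.congr (ae_restrict_of_ae h)⟩
  refine dist_ext fun t => ?_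
  rw [regular_apply hf, regular_apply hg]
  refine integral_congr_ae ?_
  filter_upwards [h] with x hx
  rw [hx]

theorem regular_add {f g : ℝ → ℝ} (hf : LocallyIntegrable f) (hg : LocallyIntegrable g) :
    regular (fun x => f x + g x) = regular f + regular g := by
  refine dist_ext fun t => ?_
  rw [regular_apply (f := fun x => f x + g x) (hf.add hg), add_apply, regular_apply hf, regular_apply hg,
    ← integral_add (integrable_mul_test hf t) (integrable_mul_test hg t)]
  simp [add_mul]

theorem regular_smul (c : ℝ) {f : ℝ → ℝ} (hf : LocallyIntegrable f) :
    regular (fun x => c * f x) = c • regular f := by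
  refine dist_ext fun t => ?_
  rw [regular_apply (f := fun x => c * f x) (hf.smul c), smul_apply, regular_apply hf, ← integral_const_mul]
  simp [mul_assoc]

theorem locallyIntegrable_sum {ι : Type*} (s : Finset ι) {f : ι → ℝ → ℝ}
    (hf : ∀ i ∈ s, LocallyIntegrable (f i)) : LocallyIntegrable (fun x => ∑ i ∈ s, f i x) := by
  classical
  induction s using Finset.induction_on with
  | empty => simpa using (locallyIntegrable_zero : LocallyIntegrable (fun _ : ℝ => (0 : ℝ)))
  | insert a s ha ih =>
    simp only [Finset.sum_insert ha]
    exact (hf a (by simp)).add (ih fun i hi => hf i (by simp [hi]))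

theorem regular_zero : regular (fun _ => 0) = 0 := by
  refine dist_ext fun t => ?_
  rw [regular_apply locallyIntegrable_zero]
  simp

theorem regular_sum {ι : Type*} (s : Finset ι) {f : ι → ℝ → ℝ}
    (hf : ∀ i ∈ s, LocallyIntegrable (f i)) :
    regular (fun x => ∑ i ∈ s, f i x) = ∑ i ∈ s, regular (f i) := by
  classical
  induction s using Finset.induction_on with
  | empty => simpa using regular_zero
  | insert a s ha ih =>
    simp only [Finset.sum_insert ha]
    have h := fun i hi => hf i (Finset.mem_insert_of_mem (b := a) hi)
    rw [regular_add (hf a (by simp)) (locallyIntegrable_sum s h), ih h]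

theorem locallyIntegrable_indicator {φ : ℝ → ℝ} (hφ : ContDiff ℝ ∞ φ) {s : Set ℝ}
    (hs : MeasurableSet s) : LocallyIntegrable (s.indicator φ) :=
  (locallyIntegrable_of_contDiff hφ).indicator hs

/-- Integration by parts on a half-line; the boundary term at a is the source of the Dirac measure
in `Dx_regular_indicator`. -/
theorem integral_Ioi_deriv_mul_test {φ : ℝ → ℝ} (hφ : ContDiff ℝ ∞ φ) (a : ℝ) (t : Test) :
    ∫ x in Ioi a, φ x * deriv t x = - (φ a * t a) - ∫ x in Ioi a, deriv φ x * t x := by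
  have h := HasCompactSupport.integral_Ioi_deriv_eq (f := smoothMul hφ t)
    ((test_contDiff (smoothMul hφ t)).of_le (by simp)) (smoothMul hφ t).hasCompactSupport a
  have h2 : ∀ x, deriv (smoothMul hφ t) x = deriv φ x * t x + φ x * deriv t x := by
    intro x
    rw [← derivTest_apply, derivTest_smoothMul]
    simp
  simp only [h2, smoothMul_apply] at h
  have i1 := (integrable_mul_test (locallyIntegrable_of_contDiff (contDiff_deriv hφ)) t)
  have i2 := (integrable_mul_test (locallyIntegrable_of_contDiff hφ) (derivTest t))
  simp only [derivTest_apply] at i2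
  rw [integral_add i1.integrableOn i2.integrableOn] at h
  linarith

theorem integral_deriv_mul_test {φ : ℝ → ℝ} (hφ : ContDiff ℝ ∞ φ) (t : Test) :
    ∫ x, φ x * deriv t x = - ∫ x, deriv φ x * t x := by
  have h : ∫ x, deriv (smoothMul hφ t) x = 0 := by
    have h1 := HasCompactSupport.integral_Ioi_deriv_eq (f := smoothMul hφ t)
      ((test_contDiff (smoothMul hφ t)).of_le (by simp)) (smoothMul hφ t).hasCompactSupport 0
    have h2 := HasCompactSupport.integral_Iic_deriv_eq (f := smoothMul hφ t)
      ((test_contDiff (smoothMul hφ t)).of_le (by simp)) (smoothMul hφ t).hasCompactSupport 0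
    have hi : Integrable (deriv (smoothMul hφ t)) := by
      have := (derivTest (smoothMul hφ t)).continuous.integrable_of_hasCompactSupport
        (derivTest (smoothMul hφ t)).hasCompactSupport (μ := volume)
      rwa [funext (derivTest_apply (smoothMul hφ t))] at this
    rw [← intervalIntegral.integral_Iic_add_Ioi hi.integrableOn hi.integrableOn (b := 0), h1, h2]
    ring
  have h2 : ∀ x, deriv (smoothMul hφ t) x = deriv φ x * t x + φ x * deriv t x := by
    intro x
    rw [← derivTest_apply, derivTest_smoothMul]
    simp
  simp only [h2] at h
  have i1 := (integrable_mul_test (locallyIntegrable_of_contDiff (contDiff_deriv hφ)) t)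
  have i2 := (integrable_mul_test (locallyIntegrable_of_contDiff hφ) (derivTest t))
  simp only [derivTest_apply] at i2
  rw [integral_add i1 i2] at h
  linarith

theorem Dx_regular {φ : ℝ → ℝ} (hφ : ContDiff ℝ ∞ φ) : Dx (regular φ) = regular (deriv φ) := by
  refine dist_ext fun t => ?_
  rw [Dx_apply_eq, regular_apply (locallyIntegrable_of_contDiff hφ),
    regular_apply (locallyIntegrable_of_contDiff (contDiff_deriv hφ))]
  simp only [derivTest_apply]
  rw [integral_deriv_mul_test hφ t, neg_neg]

theorem regular_indicator_apply {φ : ℝ → ℝ} (hφ : ContDiff ℝ ∞ φ) (a : ℝ) (t : Test) :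
    regular ((Ioi a).indicator φ) t = ∫ x in Ioi a, φ x * t x := by
  rw [regular_apply (locallyIntegrable_indicator hφ measurableSet_Ioi),
    ← integral_indicator measurableSet_Ioi]
  congr 1
  funext x
  by_cases h : x ∈ Ioi a <;> simp [indicator, h]

theorem Dx_regular_indicator {φ : ℝ → ℝ} (hφ : ContDiff ℝ ∞ φ) (a : ℝ) :
    Dx (regular ((Ioi a).indicator φ))
      = regular ((Ioi a).indicator (deriv φ)) + φ a • dirac a := by
  refine dist_ext fun t => ?_
  rw [Dx_apply_eq, add_apply, smul_apply, dirac_apply, regular_indicator_apply hφ,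
    regular_indicator_apply (contDiff_deriv hφ)]
  simp only [derivTest_apply]
  rw [integral_Ioi_deriv_mul_test hφ a t]
  ring

/-! ### Piecewise smooth functions -/

theorem PiecewiseSmooth.exists_decomp {f : ℝ → ℝ} (hf : PiecewiseSmooth f) :
    ∃ (I : Finset ℝ) (φ₀ : ℝ → ℝ) (φ : ℝ → ℝ → ℝ), ContDiff ℝ ∞ φ₀ ∧ (∀ a, ContDiff ℝ ∞ (φ a)) ∧
      ∀ x ∉ I, f x = φ₀ x + ∑ a ∈ I, (Ioi a).indicator (φ a) x := by
  obtain ⟨I, h1, h2⟩ := hf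
  exact ⟨I, exists_eq_add_sum_indicator I h1 h2⟩

theorem piecewiseSmooth_indicator {φ : ℝ → ℝ} (hφ : ContDiff ℝ ∞ φ) (a : ℝ) :
    PiecewiseSmooth ((Ioi a).indicator φ) := by
  refine ⟨{a}, fun x hx => (contDiffAt_indicator_Ioi hφ (by simpa using hx)).contDiffWithinAt,
    fun x hx n => ?_⟩
  obtain rfl : x = a := by simpa using hx
  exact ⟨⟨_, (tendsto_iteratedDeriv_indicator_Ioi hφ x n).1⟩,
    ⟨_, (tendsto_iteratedDeriv_indicator_Ioi hφ x n).2⟩⟩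

theorem ae_notMem_finset (I : Finset ℝ) : ∀ᵐ x : ℝ, x ∉ I :=
  (compl_mem_ae_iff.2 (I.finite_toSet.measure_zero volume) : (I : Set ℝ)ᶜ ∈ ae volume)

theorem locallyIntegrable_decomp (I : Finset ℝ) {φ₀ : ℝ → ℝ} {φ : ℝ → ℝ → ℝ}
    (h₀ : ContDiff ℝ ∞ φ₀) (h : ∀ a, ContDiff ℝ ∞ (φ a)) :
    LocallyIntegrable (fun x => φ₀ x + ∑ a ∈ I, (Ioi a).indicator (φ a) x) :=
  (locallyIntegrable_of_contDiff h₀).add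
    (locallyIntegrable_sum I fun a _ => locallyIntegrable_indicator (h a) measurableSet_Ioi)

theorem PiecewiseSmooth.locallyIntegrable {f : ℝ → ℝ} (hf : PiecewiseSmooth f) :
    LocallyIntegrable f := by
  obtain ⟨I, φ₀, φ, h₀, h, heq⟩ := hf.exists_decomp
  intro x
  obtain ⟨s, hs, hfs⟩ := locallyIntegrable_decomp I h₀ h x
  refine ⟨s, hs, hfs.congr (ae_restrict_of_ae ?_)⟩
  filter_upwards [ae_notMem_finset I] with y hy
  exact (heq y hy).symm

theorem regular_eq_decomp {f : ℝ → ℝ} {I : Finset ℝ} {φ₀ : ℝ → ℝ} {φ : ℝ → ℝ → ℝ}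
    (h₀ : ContDiff ℝ ∞ φ₀) (h : ∀ a, ContDiff ℝ ∞ (φ a))
    (heq : ∀ x ∉ I, f x = φ₀ x + ∑ a ∈ I, (Ioi a).indicator (φ a) x) :
    regular f = regular φ₀ + ∑ a ∈ I, regular ((Ioi a).indicator (φ a)) := by
  have hI : ∀ a ∈ I, LocallyIntegrable ((Ioi a).indicator (φ a)) :=
    fun a _ => locallyIntegrable_indicator (h a) measurableSet_Ioi
  rw [← regular_sum I hI, ← regular_add (locallyIntegrable_of_contDiff h₀)
    (locallyIntegrable_sum I hI)]
  refine (regular_congr (locallyIntegrable_decomp I h₀ h) ?_).symm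
  filter_upwards [ae_notMem_finset I] with y hy
  exact (heq y hy).symm

theorem PiecewiseSmooth.tendsto {f : ℝ → ℝ} (hf : PiecewiseSmooth f) (x₀ : ℝ) (n : ℕ) :
    (∃ l : ℝ, Tendsto (iteratedDeriv n f) (𝓝[<] x₀) (𝓝 l)) ∧
      (∃ r : ℝ, Tendsto (iteratedDeriv n f) (𝓝[>] x₀) (𝓝 r)) := by
  obtain ⟨I, h1, h2⟩ := hf
  by_cases hx : x₀ ∈ I
  · exact h2 x₀ hx n
  · have h := continuousAt_iteratedDeriv
      (h1.contDiffAt (I.finite_toSet.isClosed.isOpen_compl.mem_nhds (by simpa using hx))) n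
    exact ⟨⟨_, h.mono_left nhdsWithin_le_nhds⟩, ⟨_, h.mono_left nhdsWithin_le_nhds⟩⟩

theorem eventually_notMem_finset (I : Finset ℝ) (x : ℝ) : ∀ᶠ y in 𝓝[≠] x, y ∉ I := by
  have h1 : ((I : Set ℝ) \ {x})ᶜ ∈ 𝓝 x :=
    ((Finset.finite_toSet _).subset sdiff_subset).isClosed.isOpen_compl.mem_nhds (by simp)
  filter_upwards [mem_nhdsWithin_of_mem_nhds h1, self_mem_nhdsWithin] with y hy hyx hyI
  exact hy ⟨by exact_mod_cast hyI, hyx⟩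

theorem PiecewiseSmooth.add {f g : ℝ → ℝ} (hf : PiecewiseSmooth f) (hg : PiecewiseSmooth g) :
    PiecewiseSmooth (fun x => f x + g x) := by
  classical
  have hf' := hf.tendsto
  have hg' := hg.tendsto
  obtain ⟨I, h1, -⟩ := hf
  obtain ⟨J, h3, -⟩ := hg
  have hfa : ∀ y ∉ I, ContDiffAt ℝ ∞ f y := fun y hy =>
    h1.contDiffAt (I.finite_toSet.isClosed.isOpen_compl.mem_nhds (by simpa using hy))
  have hga : ∀ y ∉ J, ContDiffAt ℝ ∞ g y := fun y hy =>
    h3.contDiffAt (J.finite_toSet.isClosed.isOpen_compl.mem_nhds (by simpa using hy))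
  have hd : ∀ x n, ∀ᶠ y in 𝓝[≠] x, iteratedDeriv n f y + iteratedDeriv n g y
      = iteratedDeriv n (fun x => f x + g x) y := by
    intro x n
    filter_upwards [eventually_notMem_finset I x, eventually_notMem_finset J x] with y hyI hyJ
    exact (iteratedDeriv_add ((hfa y hyI).of_le (by exact_mod_cast le_top))
      ((hga y hyJ).of_le (by exact_mod_cast le_top))).symm
  refine ⟨I ∪ J, fun x hx => ?_, fun x _ n => ?_⟩
  · simp only [Finset.coe_union, compl_union] at hx
    exact ((hfa x (by simpa using hx.1)).add (hga x (by simpa using hx.2))).contDiffWithinAt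
  · obtain ⟨⟨l, hl⟩, r, hr⟩ := hf' x n
    obtain ⟨⟨l', hl'⟩, r', hr'⟩ := hg' x n
    exact ⟨⟨_, (hl.add hl').congr' ((hd x n).filter_mono
        (nhdsWithin_mono _ fun y hy => ne_of_lt hy))⟩,
      ⟨_, (hr.add hr').congr' ((hd x n).filter_mono
        (nhdsWithin_mono _ fun y hy => ne_of_gt hy))⟩⟩

theorem PiecewiseSmooth.const_mul {f : ℝ → ℝ} (hf : PiecewiseSmooth f) (c : ℝ) :
    PiecewiseSmooth (fun x => c * f x) := by
  obtain ⟨I, h1, h2⟩ := hf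
  refine ⟨I, contDiffOn_const.mul h1, fun x hx n => ?_⟩
  obtain ⟨⟨l, hl⟩, r, hr⟩ := h2 x hx n
  have h : iteratedDeriv n (fun x => c * f x) = fun x => c * iteratedDeriv n f x := by
    funext x
    exact iteratedDeriv_const_mul_field c f
  rw [h]
  exact ⟨⟨_, hl.const_mul c⟩, ⟨_, hr.const_mul c⟩⟩

/-- On both sides of a point, a piecewise smooth function agrees with a smooth function. -/
theorem PiecewiseSmooth.exists_sides {f : ℝ → ℝ} (hf : PiecewiseSmooth f) (a : ℝ) :
    ∃ (ψl ψr : ℝ → ℝ) (η : ℝ), ContDiff ℝ ∞ ψl ∧ ContDiff ℝ ∞ ψr ∧ 0 < η ∧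
      EqOn f ψl (Ioo (a - η) a) ∧ EqOn f ψr (Ioo a (a + η)) := by
  obtain ⟨I, φ₀, φ, h₀, h, heq⟩ := hf.exists_decomp
  have hI := eventually_notMem_finset I a
  rw [eventually_nhdsWithin_iff, Metric.eventually_nhds_iff] at hI
  obtain ⟨η, hη, hηI⟩ := hI
  have hnot : ∀ y, |y - a| < η → y ≠ a → y ∉ I := fun y hy hne =>
    hηI (by rwa [Real.dist_eq]) hne
  refine ⟨fun x => φ₀ x + ∑ b ∈ I with b < a, φ b x,
    fun x => φ₀ x + ∑ b ∈ I with b ≤ a, φ b x, η,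
    h₀.add (ContDiff.sum fun b _ => h b), h₀.add (ContDiff.sum fun b _ => h b), hη, ?_, ?_⟩
  · intro x hx
    have hx' : x ∉ I := hnot x (by rw [abs_lt]; constructor <;> linarith [hx.1, hx.2]) hx.2.ne
    rw [heq x hx']
    simp only [Finset.sum_filter]
    congr 1
    refine Finset.sum_congr rfl fun b hb => ?_
    by_cases hba : b < a
    · have : b < x := by
        by_contra hcon
        rw [not_lt] at hcon
        exact hnot b (by rw [abs_lt]; constructor <;> linarith [hx.1, hx.2]) hba.ne hb
      rw [if_pos hba, indicator_of_mem (by exact this)]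
    · rw [if_neg hba, indicator_of_notMem (by simp only [mem_Ioi, not_lt] at *; linarith [hx.2])]
  · intro x hx
    have hx' : x ∉ I := hnot x (by rw [abs_lt]; constructor <;> linarith [hx.1, hx.2]) hx.1.ne'
    rw [heq x hx']
    simp only [Finset.sum_filter]
    congr 1
    refine Finset.sum_congr rfl fun b hb => ?_
    by_cases hba : b ≤ a
    · rw [if_pos hba, indicator_of_mem (by exact lt_of_le_of_lt hba hx.1)]
    · have : x ≤ b := by
        by_contra hcon
        rw [not_le] at hcon hba
        exact hnot b (by rw [abs_lt]; constructor <;> linarith [hx.1, hx.2]) hba.ne' hb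
      rw [if_neg hba, indicator_of_notMem (by simpa using this)]

/-! ### Generators of `𝒜` -/

/-- A smooth function, as an element of `𝒜`. -/
noncomputable def smoothElem {φ : ℝ → ℝ} (hφ : ContDiff ℝ ∞ φ) : 𝒜 :=
  ⟨regular φ, regular_mem (piecewiseSmooth_of_contDiff hφ)⟩

/-- A smooth function cut off on the left of `a`, as an element of `𝒜`. -/
noncomputable def cutElem (a : ℝ) {φ : ℝ → ℝ} (hφ : ContDiff ℝ ∞ φ) : 𝒜 :=
  ⟨regular ((Ioi a).indicator φ), regular_mem (piecewiseSmooth_indicator hφ a)⟩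

theorem Dx_heaviside (a : ℝ) : Dx (regular ((Ioi a).indicator fun _ => 1)) = dirac a := by
  rw [Dx_regular_indicator contDiff_const, one_smul]
  simp [regular_zero]

theorem iterate_Dx_dirac_mem (a : ℝ) (n : ℕ) : Dx^[n] (dirac a) ∈ 𝒜 := by
  refine Submodule.subset_span (mem_iUnion.2 ⟨n + 1, (Ioi a).indicator fun _ => 1,
    piecewiseSmooth_indicator contDiff_const a, ?_⟩)
  rw [Function.iterate_succ_apply, Dx_heaviside]

/-- The `n`-th derivative of the Dirac measure at `a`, as an element of `𝒜`. -/
noncomputable def diracElem (a : ℝ) (n : ℕ) : 𝒜 := ⟨Dx^[n] (dirac a), iterate_Dx_dirac_mem a n⟩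

theorem pointDist_le (a : ℝ) : pointDist a ≤ 𝒜 :=
  Submodule.span_le.2 (range_subset_iff.2 fun n => iterate_Dx_dirac_mem a n)

theorem smoothElem_apply {φ : ℝ → ℝ} (hφ : ContDiff ℝ ∞ φ) (t : Test) :
    (smoothElem hφ : Dist) t = ∫ x, φ x * t x :=
  regular_apply (locallyIntegrable_of_contDiff hφ) t

theorem cutElem_apply (a : ℝ) {φ : ℝ → ℝ} (hφ : ContDiff ℝ ∞ φ) (t : Test) :
    (cutElem a hφ : Dist) t = ∫ x in Ioi a, φ x * t x :=
  regular_indicator_apply hφ a t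

theorem elem_ext {F G : 𝒜} (h : ∀ t : Test, (F : Dist) t = (G : Dist) t) : F = G :=
  Subtype.ext (dist_ext h)

theorem coe_add_apply (F G : 𝒜) (t : Test) :
    ((F + G : 𝒜) : Dist) t = (F : Dist) t + (G : Dist) t := rfl
theorem coe_sub_apply (F G : 𝒜) (t : Test) :
    ((F - G : 𝒜) : Dist) t = (F : Dist) t - (G : Dist) t := rfl
theorem coe_neg_apply (F : 𝒜) (t : Test) : ((-F : 𝒜) : Dist) t = -(F : Dist) t := rfl
theorem coe_smul_apply (c : ℝ) (F : 𝒜) (t : Test) :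
    ((c • F : 𝒜) : Dist) t = c * (F : Dist) t := rfl
theorem coe_zero_apply (t : Test) : ((0 : 𝒜) : Dist) t = 0 := rfl

/-- The distributions in `𝒜` are generated by smooth functions, truncated smooth functions, and
derivatives of Dirac measures. -/
theorem mem_span_generators {F : Dist} (hF : F ∈ 𝒜) :
    F ∈ Submodule.span ℝ ({F : Dist | ∃ φ : ℝ → ℝ, ContDiff ℝ ∞ φ ∧ F = regular φ} ∪
      {F | ∃ (a : ℝ) (φ : ℝ → ℝ), ContDiff ℝ ∞ φ ∧ F = regular ((Ioi a).indicator φ)} ∪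
      {F | ∃ (a : ℝ) (n : ℕ), F = Dx^[n] (dirac a)}) := by
  set S := Submodule.span ℝ ({F : Dist | ∃ φ : ℝ → ℝ, ContDiff ℝ ∞ φ ∧ F = regular φ} ∪
      {F | ∃ (a : ℝ) (φ : ℝ → ℝ), ContDiff ℝ ∞ φ ∧ F = regular ((Ioi a).indicator φ)} ∪
      {F | ∃ (a : ℝ) (n : ℕ), F = Dx^[n] (dirac a)}) with hS
  have h1 : ∀ {φ : ℝ → ℝ}, ContDiff ℝ ∞ φ → regular φ ∈ S := fun {φ} hφ =>
    Submodule.subset_span (Or.inl (Or.inl ⟨φ, hφ, rfl⟩))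
  have h2 : ∀ (a : ℝ) {φ : ℝ → ℝ}, ContDiff ℝ ∞ φ → regular ((Ioi a).indicator φ) ∈ S :=
    fun a {φ} hφ => Submodule.subset_span (Or.inl (Or.inr ⟨a, φ, hφ, rfl⟩))
  have h3 : ∀ (a : ℝ) (n : ℕ), Dx^[n] (dirac a) ∈ S :=
    fun a n => Submodule.subset_span (Or.inr ⟨a, n, rfl⟩)
  -- Differentiating a truncated function creates only a Dirac measure besides another truncated
  -- function. Stability under `Dx` reduces the claim to piecewise smooth functions themselves.
  have hDS : S ≤ S.comap Dx := by
    rw [hS, Submodule.span_le, ← hS]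
    rintro F ((⟨φ, hφ, rfl⟩ | ⟨a, φ, hφ, rfl⟩) | ⟨a, n, rfl⟩)
    · simp only [Submodule.comap_coe, mem_preimage, SetLike.mem_coe]
      rw [Dx_regular hφ]
      exact h1 (contDiff_deriv hφ)
    · simp only [Submodule.comap_coe, mem_preimage, SetLike.mem_coe]
      rw [Dx_regular_indicator hφ]
      exact S.add_mem (h2 a (contDiff_deriv hφ)) (S.smul_mem _ (h3 a 0))
    · simp only [Submodule.comap_coe, mem_preimage, SetLike.mem_coe]
      rw [← Function.iterate_succ_apply' (f := Dx)]
      exact h3 a (n + 1)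
  have hle : 𝒜 ≤ S := by
    refine Submodule.span_le.2 (iUnion_subset fun i => ?_)
    rintro F ⟨f, hf, rfl⟩
    induction i with
    | zero =>
      obtain ⟨I, φ₀, φ, h₀, h, heq⟩ := hf.exists_decomp
      simp only [Function.iterate_zero, id, SetLike.mem_coe]
      rw [regular_eq_decomp h₀ h heq]
      exact S.add_mem (h1 h₀) (S.sum_mem fun a _ => h2 a (h a))
    | succ i ih =>
      rw [Function.iterate_succ_apply']
      exact hDS ih
  exact hle hF

theorem generators_induction {p : 𝒜 → Prop}
    (smooth : ∀ (φ : ℝ → ℝ) (hφ : ContDiff ℝ ∞ φ), p (smoothElem hφ))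
    (cut : ∀ (a : ℝ) (φ : ℝ → ℝ) (hφ : ContDiff ℝ ∞ φ), p (cutElem a hφ))
    (dirac : ∀ (a : ℝ) (n : ℕ), p (diracElem a n))
    (add : ∀ F G, p F → p G → p (F + G)) (smul : ∀ (c : ℝ) F, p F → p (c • F)) (F : 𝒜) : p F := by
  have key : ∀ G ∈ Submodule.span ℝ ({F : Dist | ∃ φ : ℝ → ℝ, ContDiff ℝ ∞ φ ∧ F = regular φ} ∪
      {F | ∃ (a : ℝ) (φ : ℝ → ℝ), ContDiff ℝ ∞ φ ∧ F = regular ((Ioi a).indicator φ)} ∪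
      {F | ∃ (a : ℝ) (n : ℕ), F = Dx^[n] (DistAlg.dirac a)}), ∃ h : G ∈ 𝒜, p ⟨G, h⟩ := by
    intro G hG
    induction hG using Submodule.span_induction with
    | mem G hG =>
      obtain ((⟨φ, hφ, rfl⟩ | ⟨a, φ, hφ, rfl⟩) | ⟨a, n, rfl⟩) := hG
      · exact ⟨_, smooth φ hφ⟩
      · exact ⟨_, cut a φ hφ⟩
      · exact ⟨_, dirac a n⟩
    | zero =>
      have := smul 0 _ (dirac 0 0)
      rw [zero_smul] at this
      exact ⟨_, this⟩
    | add G K _ _ hG hK =>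
      obtain ⟨h1, h2⟩ := hG
      obtain ⟨h3, h4⟩ := hK
      exact ⟨_, add _ _ h2 h4⟩
    | smul c G _ hG =>
      obtain ⟨h1, h2⟩ := hG
      exact ⟨_, smul c _ h2⟩
  exact (key F (mem_span_generators F.2)).2

/-! ### The axioms and the algebra of an idempotent step -/

/-- A bilinear associative product on `𝒜`, for which the distributional derivative is a derivation,
and which extends the product of continuous functions. -/
structure IsDistProduct (mul : 𝒜 →ₗ[ℝ] 𝒜 →ₗ[ℝ] 𝒜) (D : 𝒜 →ₗ[ℝ] 𝒜) : Prop where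
  assoc : ∀ F G J : 𝒜, mul (mul F G) J = mul F (mul G J)
  leibniz : ∀ F G : 𝒜, D (mul F G) = mul (D F) G + mul F (D G)
  coe_D : ∀ F : 𝒜, (D F : Dist) = Dx (F : Dist)
  continuous : ∀ (F G : 𝒜) (f g : ℝ → ℝ), Continuous f → Continuous g →
      (F : Dist) = regular f → (G : Dist) = regular g →
      (mul F G : Dist) = regular (fun x => f x * g x)

theorem contDiff_sub_const (a : ℝ) : ContDiff ℝ ∞ fun x : ℝ => x - a :=
  contDiff_id.sub contDiff_const

theorem contDiff_one : ContDiff ℝ ∞ fun _ : ℝ => (1 : ℝ) := contDiff_const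

/-- The Heaviside function with jump at `a`, as an element of `𝒜`. -/
noncomputable def heavisideElem (a : ℝ) : 𝒜 := cutElem a contDiff_one

theorem continuous_indicator_Ioi {φ : ℝ → ℝ} (hφ : Continuous φ) {a : ℝ} (ha : φ a = 0) :
    Continuous ((Ioi a).indicator φ) := by
  refine continuous_indicator (fun x hx => ?_) hφ.continuousOn
  rw [frontier_Ioi] at hx
  rw [mem_singleton_iff.1 hx, ha]

theorem diracElem_zero_ne (a : ℝ) : diracElem a 0 ≠ 0 := by
  obtain ⟨χ, -, hχ⟩ := exists_test_eq_one (a := a) univ_mem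
  intro h
  have h1 : (diracElem a 0 : Dist) χ = 0 := by rw [h]; rfl
  have h2 : (diracElem a 0 : Dist) χ = χ a := rfl
  rw [h2, hχ.self_of_nhds] at h1
  exact one_ne_zero h1

/-- The algebra of a step function `H` with derivative `δ`, for a product in which the elements
annihilated by `X` are the multiples of `δ`. -/
theorem idempotent_dichotomy {V : Type*} [AddCommGroup V] [Module ℝ V]
    (mul : V →ₗ[ℝ] V →ₗ[ℝ] V) (D : V →ₗ[ℝ] V)
    (assoc : ∀ F G J, mul (mul F G) J = mul F (mul G J))
    (leibniz : ∀ F G, D (mul F G) = mul (D F) G + mul F (D G)) {X H δ δ' : V}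
    (hcomm : mul H X = mul X H) (hXδ : mul X δ = 0) (hXδ' : mul X δ' = -δ) (hDH : D H = δ)
    (hDδ : D δ = δ') (hδ : δ ≠ 0) (hker : ∀ T, mul X T = 0 → ∃ c : ℝ, T = c • δ)
    (hXHH : mul X (mul H H) = mul X H) :
    mul H H = H ∧ ((mul H δ = 0 ∧ mul δ H = δ) ∨ (mul H δ = δ ∧ mul δ H = 0)) := by
  -- X annihilates HH − H, δH and Hδ, the last because X commutes with H; all three are therefore
  -- multiples of δ.
  obtain ⟨c, hc⟩ := hker (mul H H - H) (by rw [map_sub, hXHH, sub_self])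
  obtain ⟨α, hα⟩ := hker (mul δ H) (by rw [← assoc, hXδ, map_zero, LinearMap.zero_apply])
  obtain ⟨β, hβ⟩ := hker (mul H δ) (by rw [← assoc, ← hcomm, assoc, hXδ, map_zero])
  have hHH : mul H H = H + c • δ := by rw [← hc]; abel
  have hD : (α + β) • δ = δ + c • δ' := by
    have h1 := congrArg D hHH
    rw [leibniz, map_add, map_smul, hDH, hDδ, hα, hβ, ← add_smul] at h1
    exact h1
  -- Multiplication by X kills δ and sends δ' to −δ, which isolates c in the differentiated
  -- relation.
  have hc0 : c = 0 := by
    have h1 := congrArg (mul X) hD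
    rw [map_smul, map_add, hXδ, map_smul, hXδ', smul_zero, zero_add, smul_neg, eq_comm,
      neg_eq_zero, smul_eq_zero] at h1
    exact h1.resolve_right hδ
  rw [hc0, zero_smul, add_zero] at hD hHH
  have hαβ : α + β = 1 := by
    have h1 : (α + β - 1) • δ = 0 := by rw [sub_smul, hD, one_smul, sub_self]
    linarith [(smul_eq_zero.1 h1).resolve_right hδ]
  -- Associativity: H(Hδ) = (HH)δ = Hδ.
  have hββ : β * β = β := by
    have h1 : mul H (mul H δ) = mul H δ := by rw [← assoc, hHH]
    rw [hβ, map_smul, hβ, smul_smul] at h1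
    have h2 : (β * β - β) • δ = 0 := by rw [sub_smul, h1, sub_self]
    linarith [(smul_eq_zero.1 h2).resolve_right hδ]
  refine ⟨hHH, ?_⟩
  have hcases : β * (β - 1) = 0 := by linarith
  rcases mul_eq_zero.1 hcases with hb | hb
  · left
    rw [hα, hβ, hb, show α = 1 by linarith, zero_smul, one_smul]
    exact ⟨rfl, rfl⟩
  · right
    rw [hα, hβ, show β = 1 by linarith, show α = 0 by linarith, zero_smul, one_smul]
    exact ⟨rfl, rfl⟩

namespace IsDistProduct

variable {mul : 𝒜 →ₗ[ℝ] 𝒜 →ₗ[ℝ] 𝒜} {D : 𝒜 →ₗ[ℝ] 𝒜} (h : IsDistProduct mul D)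
include h

/-- The axioms are symmetric in left and right, so each one-sided result also holds for the opposite
product. -/
theorem flip : IsDistProduct mul.flip D where
  assoc F G J := (h.assoc J G F).symm
  leibniz F G := by
    simp only [LinearMap.flip_apply]
    rw [h.leibniz, add_comm]
  coe_D := h.coe_D
  continuous F G f g hf hg hF hG := by
    simp only [LinearMap.flip_apply, mul_comm (f _)]
    exact h.continuous G F g f hg hf hG hF

/-! ### Multiplication by smooth functions -/

theorem D_smooth {φ : ℝ → ℝ} (hφ : ContDiff ℝ ∞ φ) :
    D (smoothElem hφ) = smoothElem (contDiff_deriv hφ) :=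
  Subtype.ext ((h.coe_D _).trans (Dx_regular hφ))

theorem D_cut (a : ℝ) {φ : ℝ → ℝ} (hφ : ContDiff ℝ ∞ φ) :
    D (cutElem a hφ) = cutElem a (contDiff_deriv hφ) + φ a • diracElem a 0 :=
  Subtype.ext ((h.coe_D _).trans (Dx_regular_indicator hφ a))

theorem D_heaviside (a : ℝ) : D (heavisideElem a) = diracElem a 0 :=
  Subtype.ext ((h.coe_D _).trans (Dx_heaviside a))

theorem D_dirac (a : ℝ) (n : ℕ) : D (diracElem a n) = diracElem a (n + 1) :=
  Subtype.ext ((h.coe_D _).trans (Function.iterate_succ_apply' _ _ _).symm)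

/-- The Leibniz rule reads φ·DF = D(φF) − φ'F, and both terms on the right are dual products. The
hypothesis is needed for every smooth φ because φ' occurs. -/
theorem smooth_mul_D_of_smooth_mul {F : 𝒜}
    (hF : ∀ (φ : ℝ → ℝ) (hφ : ContDiff ℝ ∞ φ) (t : Test),
      (mul (smoothElem hφ) F : Dist) t = (F : Dist) (smoothMul hφ t))
    (φ : ℝ → ℝ) (hφ : ContDiff ℝ ∞ φ) (t : Test) :
    (mul (smoothElem hφ) (D F) : Dist) t = (D F : Dist) (smoothMul hφ t) := by
  have h1 : mul (smoothElem hφ) (D F)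
      = D (mul (smoothElem hφ) F) - mul (smoothElem (contDiff_deriv hφ)) F := by
    rw [h.leibniz, h.D_smooth]
    abel
  rw [h1, coe_sub_apply, h.coe_D, h.coe_D, Dx_apply_eq, Dx_apply_eq, hF, hF, derivTest_smoothMul,
    map_add]
  ring

theorem smooth_mul_of_continuous {F : 𝒜} {f : ℝ → ℝ} (hf : Continuous f)
    (hF : (F : Dist) = regular f) (φ : ℝ → ℝ) (hφ : ContDiff ℝ ∞ φ) (t : Test) :
    (mul (smoothElem hφ) F : Dist) t = (F : Dist) (smoothMul hφ t) := by
  rw [h.continuous (smoothElem hφ) F φ f hφ.continuous hf rfl hF, hF,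
    regular_apply (f := fun x => φ x * f x) (hφ.continuous.mul hf).locallyIntegrable, regular_apply hf.locallyIntegrable]
  congr 1
  funext x
  simp only [smoothMul_apply]
  ring

/-- The product by a smooth function is the dual product. -/
theorem smooth_mul_apply {φ : ℝ → ℝ} (hφ : ContDiff ℝ ∞ φ) (F : 𝒜) (t : Test) :
    (mul (smoothElem hφ) F : Dist) t = (F : Dist) (smoothMul hφ t) := by
  have cutcont : ∀ (a : ℝ) (ψ : ℝ → ℝ) (hψ : ContDiff ℝ ∞ ψ), ψ a = 0 →
      ∀ (φ : ℝ → ℝ) (hφ : ContDiff ℝ ∞ φ) (t : Test),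
        (mul (smoothElem hφ) (cutElem a hψ) : Dist) t = (cutElem a hψ : Dist) (smoothMul hφ t) :=
    fun a ψ hψ ha => h.smooth_mul_of_continuous (continuous_indicator_Ioi hψ.continuous ha) rfl
  have cut : ∀ (a : ℝ) (ψ : ℝ → ℝ) (hψ : ContDiff ℝ ∞ ψ),
      ∀ (φ : ℝ → ℝ) (hφ : ContDiff ℝ ∞ φ) (t : Test),
        (mul (smoothElem hφ) (cutElem a hψ) : Dist) t
          = (cutElem a hψ : Dist) (smoothMul hφ t) := by
    intro a ψ hψ
    -- The primitive vanishing at a: cut off at a it is continuous, so (A4) applies, and its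
    -- derivative is the truncation of ψ without a Dirac term.
    let Ψ : ℝ → ℝ := fun x => ∫ y in a..x, ψ y
    have hder : ∀ x, HasDerivAt Ψ (ψ x) x := fun x => hψ.continuous.integral_hasStrictDerivAt a x
      |>.hasDerivAt
    have hd : deriv Ψ = ψ := funext fun x => (hder x).deriv
    have hΨ : ContDiff ℝ ∞ Ψ :=
      contDiff_infty_iff_deriv.2 ⟨fun x => (hder x).differentiableAt, by rwa [hd]⟩
    have hΨa : Ψ a = 0 := intervalIntegral.integral_same
    have hD : D (cutElem a hΨ) = cutElem a hψ := by
      rw [h.D_cut, hΨa, zero_smul, add_zero]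
      exact Subtype.ext (congrArg (fun f => regular ((Ioi a).indicator f)) hd)
    rw [← hD]
    exact h.smooth_mul_D_of_smooth_mul (cutcont a Ψ hΨ hΨa)
  induction F using generators_induction generalizing φ t with
  | smooth ψ hψ => exact h.smooth_mul_of_continuous hψ.continuous rfl φ hφ t
  | cut a ψ hψ => exact cut a ψ hψ φ hφ t
  | dirac a n =>
    induction n generalizing φ t with
    | zero =>
      rw [← h.D_heaviside]
      exact h.smooth_mul_D_of_smooth_mul (cut a _ contDiff_one) φ hφ t
    | succ n ih =>
      rw [← h.D_dirac]
      exact h.smooth_mul_D_of_smooth_mul (fun φ hφ t => ih hφ t) φ hφ t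
  | add F G hF hG => rw [map_add, coe_add_apply, coe_add_apply, hF, hG]
  | smul c F hF => rw [map_smul, coe_smul_apply, coe_smul_apply, hF]

theorem mul_smooth_apply {φ : ℝ → ℝ} (hφ : ContDiff ℝ ∞ φ) (F : 𝒜) (t : Test) :
    (mul F (smoothElem hφ) : Dist) t = (F : Dist) (smoothMul hφ t) :=
  h.flip.smooth_mul_apply hφ F t

theorem mul_smooth_comm {φ : ℝ → ℝ} (hφ : ContDiff ℝ ∞ φ) (F : 𝒜) :
    mul F (smoothElem hφ) = mul (smoothElem hφ) F :=
  elem_ext fun t => by rw [h.mul_smooth_apply, h.smooth_mul_apply]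

theorem one_mul (F : 𝒜) : mul (smoothElem contDiff_one) F = F :=
  elem_ext fun t => by
    rw [h.smooth_mul_apply]
    congr 1
    ext x
    simp

theorem smooth_mul_cut (a : ℝ) {φ ψ : ℝ → ℝ} (hφ : ContDiff ℝ ∞ φ) (hψ : ContDiff ℝ ∞ ψ) :
    mul (smoothElem hφ) (cutElem a hψ) = cutElem a (hφ.mul hψ) :=
  elem_ext fun t => by
    rw [h.smooth_mul_apply, cutElem_apply, cutElem_apply]
    congr 1
    funext x
    simp only [smoothMul_apply]
    ring

theorem smooth_mul_smooth {φ ψ : ℝ → ℝ} (hφ : ContDiff ℝ ∞ φ) (hψ : ContDiff ℝ ∞ ψ) :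
    mul (smoothElem hφ) (smoothElem hψ) = smoothElem (hφ.mul hψ) :=
  Subtype.ext (h.continuous _ _ φ ψ hφ.continuous hψ.continuous rfl rfl)

theorem cut_eq (a : ℝ) {φ : ℝ → ℝ} (hφ : ContDiff ℝ ∞ φ) :
    cutElem a hφ = mul (smoothElem hφ) (heavisideElem a) := by
  rw [heavisideElem, h.smooth_mul_cut]
  exact Subtype.ext (congrArg (fun f => regular ((Ioi a).indicator f)) (by simp))

/-! ### The Heaviside function and the Dirac measure at its jump -/

/-- A distribution annihilated by `x - a` is a multiple of the Dirac measure at `a`. -/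
theorem exists_smul_dirac {a : ℝ} {T : 𝒜} (hT : mul (smoothElem (contDiff_sub_const a)) T = 0) :
    ∃ c : ℝ, T = c • diracElem a 0 := by
  obtain ⟨χ, -, hχ⟩ := exists_test_eq_one (a := a) univ_mem
  have hχa : χ a = 1 := hχ.self_of_nhds
  refine ⟨(T : Dist) χ, elem_ext fun t => ?_⟩
  rw [coe_smul_apply]
  change _ = (T : Dist) χ * t a
  -- Subtracting a multiple of χ makes the test function vanish at a. By Hadamard's lemma it is then
  -- x − a times a test function, on which T gives 0.
  let r : Test := t - t a • χ
  have hra : r a = 0 := by simp [r, hχa]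
  obtain ⟨s, hs, hrs⟩ := exists_contDiff_eq_mul (test_contDiff r) hra
  have hsc : HasCompactSupport s := by
    refine HasCompactSupport.intro (K := tsupport r ∪ {a})
      (r.hasCompactSupport.isCompact.union isCompact_singleton) fun x hx => ?_
    simp only [mem_union, mem_singleton_iff, not_or] at hx
    have := hrs x
    rw [image_eq_zero_of_notMem_tsupport hx.1, eq_comm, mul_eq_zero, sub_eq_zero] at this
    exact this.resolve_left hx.2
  let S : Test := ⟨s, hs, hsc, by simp⟩
  have hr : r = smoothMul (contDiff_sub_const a) S := by
    ext x
    rw [hrs x]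
    rfl
  have h1 : (T : Dist) r = 0 := by
    rw [hr, ← h.smooth_mul_apply, hT]
    rfl
  have h2 : t = r + t a • χ := by simp [r]
  calc (T : Dist) t = (T : Dist) (r + t a • χ) := by rw [← h2]
    _ = (T : Dist) χ * t a := by rw [map_add, h1, map_smul, smul_eq_mul]; ring

theorem sub_mul_dirac (a : ℝ) : mul (smoothElem (contDiff_sub_const a)) (diracElem a 0) = 0 :=
  elem_ext fun t => by
    rw [h.smooth_mul_apply]
    change (a - a) * t a = 0
    ring

/-- XH is continuous, so (A4) computes its square. Since D(XH) = H and X commutes with everything,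
differentiating the square gives 2·X(HH) = 2·XH. -/
theorem sub_mul_heaviside_mul_heaviside (a : ℝ) :
    mul (smoothElem (contDiff_sub_const a)) (mul (heavisideElem a) (heavisideElem a))
      = mul (smoothElem (contDiff_sub_const a)) (heavisideElem a) := by
  set X := smoothElem (contDiff_sub_const a) with hX
  set H := heavisideElem a with hH
  have hXH : mul X H = cutElem a (contDiff_sub_const a) := (h.cut_eq a _).symm
  have hsq : mul (mul X H) (mul X H)
      = cutElem a ((contDiff_sub_const a).mul (contDiff_sub_const a)) := by
    rw [hXH]
    have hc : Continuous ((Ioi a).indicator fun x => x - a) :=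
      continuous_indicator_Ioi (contDiff_sub_const a).continuous (sub_self a)
    refine Subtype.ext ((h.continuous _ _ _ _ hc hc rfl rfl).trans ?_)
    change regular _ = regular _
    congr 1
    funext x
    by_cases hx : x ∈ Ioi a <;> simp [indicator, hx]
  have hdX : D (mul X H) = H := by
    rw [hXH, h.D_cut, sub_self, zero_smul, add_zero]
    refine Subtype.ext (congrArg (fun f => regular ((Ioi a).indicator f)) ?_)
    funext x
    simp
  have hdsq : D (mul (mul X H) (mul X H)) = (2 : ℝ) • mul X H := by
    rw [hsq, h.D_cut, sub_self, mul_zero, zero_smul, add_zero, hXH]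
    refine Subtype.ext ?_
    change regular _ = (2 : ℝ) • regular _
    rw [← regular_smul 2 (locallyIntegrable_indicator (contDiff_sub_const a) measurableSet_Ioi)]
    congr 1
    funext x
    have hd : deriv (fun x => (x - a) * (x - a)) x = 2 * (x - a) := by
      have h1 : HasDerivAt (fun x => x - a) 1 x := (hasDerivAt_id x).sub_const a
      exact (h1.mul h1).deriv.trans (by ring)
    by_cases hx : x ∈ Ioi a
    · rw [indicator_of_mem hx, indicator_of_mem hx, hd]
    · rw [indicator_of_notMem hx, indicator_of_notMem hx, mul_zero]
  rw [h.leibniz, hdX] at hdsq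
  have h1 : mul H (mul X H) = mul X (mul H H) := by
    rw [← h.assoc, h.mul_smooth_comm, h.assoc]
  have h2 : mul (mul X H) H = mul X (mul H H) := h.assoc X H H
  rw [h1, h2, ← two_smul ℝ] at hdsq
  exact smul_right_injective 𝒜 (two_ne_zero (α := ℝ)) hdsq

theorem sub_mul_dirac_one (a : ℝ) :
    mul (smoothElem (contDiff_sub_const a)) (diracElem a 1) = -diracElem a 0 :=
  elem_ext fun t => by
    rw [h.smooth_mul_apply, coe_neg_apply]
    change Dx (dirac a) _ = - t a
    rw [Dx_apply_eq, dirac_apply, derivTest_smoothMul]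
    change -(deriv (fun x => x - a) a * t a + (a - a) * derivTest t a) = - t a
    rw [sub_self, zero_mul, add_zero, deriv_sub_const, deriv_id'', _root_.one_mul]

/-- The Heaviside function is idempotent, and its products with the Dirac measure are trivial. -/
theorem heaviside_dichotomy (a : ℝ) :
    mul (heavisideElem a) (heavisideElem a) = heavisideElem a ∧
    ((mul (heavisideElem a) (diracElem a 0) = 0 ∧
        mul (diracElem a 0) (heavisideElem a) = diracElem a 0) ∨
      (mul (heavisideElem a) (diracElem a 0) = diracElem a 0 ∧
        mul (diracElem a 0) (heavisideElem a) = 0)) :=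
  idempotent_dichotomy mul D h.assoc h.leibniz (h.mul_smooth_comm (contDiff_sub_const a) _)
    (h.sub_mul_dirac a) (h.sub_mul_dirac_one a) (h.D_heaviside a) (h.D_dirac a 0)
    (diracElem_zero_ne a) (fun _ hT => h.exists_smul_dirac hT)
    (h.sub_mul_heaviside_mul_heaviside a)

/-- Differentiating Kδ⁽ⁿ⁾ = 0 gives e·δδ⁽ⁿ⁾ + Kδ⁽ⁿ⁺¹⁾ = 0. Multiplying by K on the left kills the
first term, as Kδ = 0, and leaves the second unchanged, as KK = K. It is applied with K = H and with
K = 1 − H. -/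
theorem idempotent_mul_dirac {a : ℝ} {K : 𝒜} {e : ℝ} (hK : mul K K = K)
    (hDK : D K = e • diracElem a 0) (h0 : mul K (diracElem a 0) = 0) (n : ℕ) :
    mul K (diracElem a n) = 0 := by
  induction n with
  | zero => exact h0
  | succ n ih =>
    have h1 := h.leibniz K (diracElem a n)
    rw [ih, map_zero, hDK, h.D_dirac, map_smul, LinearMap.smul_apply] at h1
    have h2 := congrArg (mul K) h1
    rw [map_zero, map_add, map_smul, ← h.assoc, h0, map_zero, LinearMap.zero_apply, smul_zero,
      zero_add, ← h.assoc, hK] at h2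
    exact h2.symm

/-- The product of the Heaviside function by the Dirac measure at its jump determines its products
by all the derivatives of the Dirac measure. -/
theorem heaviside_mul_dirac (a : ℝ) (n : ℕ) :
    (mul (heavisideElem a) (diracElem a 0) = 0 → mul (heavisideElem a) (diracElem a n) = 0) ∧
    (mul (heavisideElem a) (diracElem a 0) ≠ 0 →
      mul (heavisideElem a) (diracElem a n) = diracElem a n) := by
  obtain ⟨hHH, hdich⟩ := h.heaviside_dichotomy a
  constructor
  · intro h0
    exact h.idempotent_mul_dirac (e := 1) hHH (by rw [h.D_heaviside, one_smul]) h0 n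
  · intro h0
    have h1 : mul (heavisideElem a) (diracElem a 0) = diracElem a 0 := by
      rcases hdich with h1 | h1
      · exact absurd h1.1 h0
      · exact h1.1
    set U := smoothElem contDiff_one with hU
    -- If H fixes δ, the complementary idempotent 1 − H annihilates it, and has derivative −δ.
    have hUH : mul (U - heavisideElem a) (diracElem a n) = 0 := by
      refine h.idempotent_mul_dirac (e := -1) ?_ ?_ ?_ n
      · simp only [map_sub, LinearMap.sub_apply, h.one_mul, hU, hHH, h.mul_smooth_comm]
        abel
      · rw [map_sub, h.D_smooth, h.D_heaviside]
        have : smoothElem (contDiff_deriv contDiff_one) = 0 := elem_ext fun t => by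
          rw [smoothElem_apply, coe_zero_apply]
          simp
        rw [this]
        simp
      · rw [map_sub, LinearMap.sub_apply, h.one_mul, h1, sub_self]
    rw [map_sub, LinearMap.sub_apply, h.one_mul, sub_eq_zero] at hUH
    exact hUH.symm

/-- Passing to the opposite product exchanges the two alternatives of `heaviside_dichotomy`, hence
replaces M by its complement. -/
theorem flip_eq_zero_iff (a : ℝ) :
    mul.flip (heavisideElem a) (diracElem a 0) = 0 ↔
      mul (heavisideElem a) (diracElem a 0) ≠ 0 := by
  rw [LinearMap.flip_apply]
  have hδ := diracElem_zero_ne a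
  rcases (h.heaviside_dichotomy a).2 with ⟨h1, h2⟩ | ⟨h1, h2⟩
  · rw [h1, h2]; simp [hδ]
  · rw [h1, h2]; simp [hδ]

/-! ### Products with distributions supported at a point -/

theorem smooth_mul_point {a : ℝ} {φ : ℝ → ℝ} (hφ : ContDiff ℝ ∞ φ) (h1 : ∀ᶠ x in 𝓝 a, φ x = 1)
    {G : 𝒜} (hG : (G : Dist) ∈ pointDist a) : mul (smoothElem hφ) G = G :=
  elem_ext fun t => by
    rw [h.smooth_mul_apply]
    refine pointDist_congr hG ?_
    filter_upwards [h1] with x hx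
    simp [hx]

theorem smooth_mul_point_eq_zero {a : ℝ} {φ : ℝ → ℝ} (hφ : ContDiff ℝ ∞ φ)
    (h1 : ∀ᶠ x in 𝓝 a, φ x = 0) {G : 𝒜} (hG : (G : Dist) ∈ pointDist a) :
    mul (smoothElem hφ) G = 0 :=
  elem_ext fun t => by
    rw [h.smooth_mul_apply]
    refine pointDist_eq_zero hG ?_
    filter_upwards [h1] with x hx
    simp [hx]

theorem heaviside_mul_point {a : ℝ} {G : 𝒜} (hG : (G : Dist) ∈ pointDist a) :
    (mul (heavisideElem a) (diracElem a 0) = 0 → mul (heavisideElem a) G = 0) ∧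
    (mul (heavisideElem a) (diracElem a 0) ≠ 0 → mul (heavisideElem a) G = G) := by
  obtain ⟨G, hGA⟩ := G
  simp only at hG
  have key : ∃ h' : G ∈ 𝒜, (mul (heavisideElem a) (diracElem a 0) = 0 →
        mul (heavisideElem a) ⟨G, h'⟩ = 0) ∧
      (mul (heavisideElem a) (diracElem a 0) ≠ 0 → mul (heavisideElem a) ⟨G, h'⟩ = ⟨G, h'⟩) := by
    clear hGA
    induction hG using Submodule.span_induction with
    | mem F hF =>
      obtain ⟨n, rfl⟩ := hF
      exact ⟨iterate_Dx_dirac_mem a n, h.heaviside_mul_dirac a n⟩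
    | zero => exact ⟨zero_mem _, fun _ => map_zero _, fun _ => map_zero _⟩
    | add F G _ _ hF hG =>
      obtain ⟨h1, h2, h3⟩ := hF
      obtain ⟨h4, h5, h6⟩ := hG
      refine ⟨add_mem h1 h4, fun h0 => ?_, fun h0 => ?_⟩
      · rw [show (⟨F + G, add_mem h1 h4⟩ : 𝒜) = ⟨F, h1⟩ + ⟨G, h4⟩ from rfl, map_add, h2 h0, h5 h0,
          add_zero]
      · rw [show (⟨F + G, add_mem h1 h4⟩ : 𝒜) = ⟨F, h1⟩ + ⟨G, h4⟩ from rfl, map_add, h3 h0, h6 h0]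
    | smul c F _ hF =>
      obtain ⟨h1, h2, h3⟩ := hF
      refine ⟨𝒜.smul_mem c h1, fun h0 => ?_, fun h0 => ?_⟩
      · rw [show (⟨c • F, 𝒜.smul_mem c h1⟩ : 𝒜) = c • ⟨F, h1⟩ from rfl, map_smul, h2 h0, smul_zero]
      · rw [show (⟨c • F, 𝒜.smul_mem c h1⟩ : 𝒜) = c • ⟨F, h1⟩ from rfl, map_smul, h3 h0]
  exact key.2

/-- At a common point, compare (FH)G with F(HG): H acts as the identity on exactly one side and as 0
on the other, so one expression is FG and the other is 0. At distinct points a smooth function equal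
to 1 near a and 0 near b is inserted instead. -/
theorem point_mul_point {a b : ℝ} {F G : 𝒜} (hF : (F : Dist) ∈ pointDist a)
    (hG : (G : Dist) ∈ pointDist b) : mul F G = 0 := by
  by_cases hab : a = b
  · subst hab
    have h1 := h.heaviside_mul_point hG
    have h2 := h.flip.heaviside_mul_point hF
    rw [ne_eq, h.flip_eq_zero_iff, not_not] at h2
    simp only [LinearMap.flip_apply] at h2
    have h3 := h.assoc F (heavisideElem a) G
    by_cases h0 : mul (heavisideElem a) (diracElem a 0) = 0
    · rwa [h1.1 h0, map_zero, h2.2 h0] at h3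
    · rwa [h1.2 h0, h2.1 h0, map_zero, LinearMap.zero_apply, eq_comm] at h3
  · obtain ⟨χ, hχs, hχ⟩ := exists_test_eq_one (isOpen_ne.mem_nhds hab)
    have h1 := h.flip.smooth_mul_point (test_contDiff χ) hχ hF
    have h2 : mul (smoothElem (test_contDiff χ)) G = 0 := by
      refine h.smooth_mul_point_eq_zero _ ?_ hG
      have hb : b ∉ tsupport χ := fun hb => hχs hb rfl
      filter_upwards [(isClosed_tsupport χ).isOpen_compl.mem_nhds hb] with x hx
      exact image_eq_zero_of_notMem_tsupport hx
    rw [LinearMap.flip_apply] at h1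
    rw [← h1, h.assoc, h2, map_zero]

/-- The product of a piecewise smooth function by a distribution supported at a point `a` only
depends on the function on one side of `a`. -/
theorem regular_mul_point {a : ℝ} {f ψl ψr : ℝ → ℝ} {η : ℝ} (hf : PiecewiseSmooth f)
    (hψl : ContDiff ℝ ∞ ψl) (hψr : ContDiff ℝ ∞ ψr) (hη : 0 < η)
    (hl : EqOn f ψl (Ioo (a - η) a)) (hr : EqOn f ψr (Ioo a (a + η)))
    {G : 𝒜} (hG : (G : Dist) ∈ pointDist a) :
    (mul (heavisideElem a) (diracElem a 0) = 0 →
      mul ⟨regular f, regular_mem hf⟩ G = mul (smoothElem hψl) G) ∧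
    (mul (heavisideElem a) (diracElem a 0) ≠ 0 →
      mul ⟨regular f, regular_mem hf⟩ G = mul (smoothElem hψr) G) := by
  obtain ⟨χ, hχs, hχ⟩ := exists_test_eq_one (Ioo_mem_nhds (sub_lt_self a hη) (lt_add_of_pos_right a hη))
  have hχc := test_contDiff χ
  have hχG := h.smooth_mul_point hχc hχ hG
  -- Localised near a, f is ψl plus the jump part ψr − ψl cut off at a; the value of f at a is
  -- irrelevant, since equality almost everywhere suffices.
  have hfχ : mul ⟨regular f, regular_mem hf⟩ (smoothElem hχc)
      = smoothElem (hψl.mul hχc) + cutElem a ((hψr.sub hψl).mul hχc) := by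
    refine elem_ext fun t => ?_
    rw [h.mul_smooth_apply, coe_add_apply, smoothElem_apply]
    change regular f _ = _ + regular _ t
    rw [regular_apply hf.locallyIntegrable, regular_apply
      (locallyIntegrable_indicator ((hψr.sub hψl).mul hχc) measurableSet_Ioi),
      ← integral_add (integrable_mul_test (locallyIntegrable_of_contDiff (hψl.mul hχc)) t)
        (integrable_mul_test (locallyIntegrable_indicator ((hψr.sub hψl).mul hχc)
          measurableSet_Ioi) t)]
    refine integral_congr_ae ?_
    filter_upwards [ae_notMem_finset {a}] with x hx
    rw [Finset.mem_singleton] at hx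
    rw [smoothMul_apply]
    by_cases hxs : x ∈ tsupport χ
    · have hx2 := hχs hxs
      rcases lt_or_gt_of_ne hx with hlt | hgt
      · rw [hl ⟨hx2.1, hlt⟩, indicator_of_notMem (by simpa using hlt.le)]
        ring
      · rw [hr ⟨hgt, hx2.2⟩, indicator_of_mem (by exact hgt)]
        ring
    · have h0 : χ x = 0 := image_eq_zero_of_notMem_tsupport hxs
      have h1 : (Ioi a).indicator (fun x => (ψr x - ψl x) * χ x) x = 0 := by
        by_cases hxa : x ∈ Ioi a <;> simp [indicator, h0]
      rw [h1, h0]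
      ring
  -- Replacing G by χG moves the cutoff onto f; afterwards χ commutes past H and is absorbed by G
  -- again.
  have hfG : mul ⟨regular f, regular_mem hf⟩ G
      = mul (smoothElem hψl) G
        + mul (smoothElem (hψr.sub hψl)) (mul (heavisideElem a) G) := by
    conv_lhs => rw [← hχG, ← h.assoc, hfχ]
    rw [map_add, LinearMap.add_apply, ← h.smooth_mul_smooth hψl hχc, h.assoc, hχG, h.cut_eq,
      ← h.smooth_mul_smooth (hψr.sub hψl) hχc, h.assoc, h.assoc]
    congr 2
    rw [← h.assoc, ← h.mul_smooth_comm, h.assoc, hχG]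
  obtain ⟨h1, h2⟩ := h.heaviside_mul_point hG
  constructor
  · intro h0
    rw [hfG, h1 h0, map_zero, add_zero]
  · intro h0
    rw [hfG, h2 h0]
    refine elem_ext fun t => ?_
    rw [coe_add_apply, h.smooth_mul_apply, h.smooth_mul_apply, h.smooth_mul_apply, ← map_add]
    congr 1
    ext x
    simp only [smoothMul_apply]
    change ψl x * t x + (ψr x - ψl x) * t x = _
    ring

/-! ### Products of piecewise smooth functions -/

theorem heaviside_mul_heaviside_of_lt {a b : ℝ} (hab : a < b) :
    mul (heavisideElem a) (heavisideElem b) = heavisideElem b := by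
  -- χ is 0 to the left of a and 1 to the right of b, so it is fixed by the first Heaviside function
  -- and fixes the second; associativity does the rest.
  let χ : ℝ → ℝ := fun x => Real.smoothTransition ((x - a) / (b - a))
  have hχ : ContDiff ℝ ∞ χ :=
    Real.smoothTransition.contDiff.comp ((contDiff_sub_const a).div_const _)
  have h1 : mul (smoothElem hχ) (heavisideElem b) = heavisideElem b := by
    rw [← h.cut_eq]
    refine Subtype.ext (congrArg regular (indicator_congr fun x hx => ?_))
    exact Real.smoothTransition.one_of_one_le
      ((one_le_div (by linarith)).2 (by linarith [mem_Ioi.1 hx]))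
  have h2 : mul (heavisideElem a) (smoothElem hχ) = smoothElem hχ := by
    rw [h.mul_smooth_comm, ← h.cut_eq]
    refine Subtype.ext (congrArg regular (funext fun x => ?_))
    by_cases hx : x ∈ Ioi a
    · rw [indicator_of_mem hx]
    · rw [indicator_of_notMem hx]
      exact (Real.smoothTransition.zero_of_nonpos
        (div_nonpos_of_nonpos_of_nonneg (by linarith [notMem_Ioi.1 hx]) (by linarith))).symm
  rw [← h1, ← h.assoc, h2]

theorem heaviside_mul_heaviside (a b : ℝ) :
    mul (heavisideElem a) (heavisideElem b) = heavisideElem (max a b) := by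
  rcases lt_trichotomy a b with hab | rfl | hab
  · rw [max_eq_right hab.le, h.heaviside_mul_heaviside_of_lt hab]
  · rw [max_self, (h.heaviside_dichotomy a).1]
  · rw [max_eq_left hab.le]
    exact h.flip.heaviside_mul_heaviside_of_lt hab

theorem cut_mul_cut (a b : ℝ) {φ ψ : ℝ → ℝ} (hφ : ContDiff ℝ ∞ φ) (hψ : ContDiff ℝ ∞ ψ) :
    mul (cutElem a hφ) (cutElem b hψ) = cutElem (max a b) (hφ.mul hψ) := by
  rw [h.cut_eq a, h.cut_eq b, h.cut_eq (max a b), ← h.heaviside_mul_heaviside,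
    ← h.smooth_mul_smooth, h.assoc, h.assoc, ← h.assoc (heavisideElem a), h.mul_smooth_comm hψ,
    h.assoc]

/-- Splitting f into a smooth part and cuts reduces the claim to `cut_mul_cut`; intersecting
half-lines turns the maximum of the jump points into a product of indicators. -/
theorem regular_mul_cut {f : ℝ → ℝ} (hf : PiecewiseSmooth f) (b : ℝ) {ψ : ℝ → ℝ}
    (hψ : ContDiff ℝ ∞ ψ) (t : Test) :
    (mul ⟨regular f, regular_mem hf⟩ (cutElem b hψ) : Dist) t
      = ∫ x in Ioi b, f x * (ψ x * t x) := by
  obtain ⟨I, φ₀, φ, h₀, hφ, heq⟩ := hf.exists_decomp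
  have hF : (⟨regular f, regular_mem hf⟩ : 𝒜) = smoothElem h₀ + ∑ a ∈ I, cutElem a (hφ a) := by
    refine Subtype.ext ?_
    simp only [Submodule.coe_add, Submodule.coe_sum]
    exact regular_eq_decomp h₀ hφ heq
  rw [hF, map_add, map_sum, LinearMap.add_apply, LinearMap.sum_apply, coe_add_apply,
    Submodule.coe_sum, sum_apply, h.smooth_mul_cut]
  simp only [h.cut_mul_cut, cutElem_apply]
  have i0 := integrable_mul_test (locallyIntegrable_of_contDiff (h₀.mul hψ)) t
  have i1 : ∀ a, Integrable fun x => (Ioi a).indicator (fun x => φ a x * ψ x) x * t x := fun a =>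
    integrable_mul_test (locallyIntegrable_indicator ((hφ a).mul hψ) measurableSet_Ioi) t
  have e1 : ∀ a, ∫ x in Ioi (max a b), φ a x * ψ x * t x
      = ∫ x in Ioi b, (Ioi a).indicator (fun x => φ a x * ψ x) x * t x := by
    intro a
    rw [← integral_indicator measurableSet_Ioi, ← integral_indicator measurableSet_Ioi]
    congr 1
    funext x
    by_cases hxa : x ∈ Ioi a <;> by_cases hxb : x ∈ Ioi b <;>
      simp_all only [indicator, mem_Ioi, max_lt_iff, if_true, if_false, and_true,
        and_false, zero_mul, and_self]
  simp only [e1]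
  rw [← integral_finsetSum _ fun a _ => (i1 a).integrableOn,
    ← integral_add i0.integrableOn (integrable_finsetSum _ fun a _ => (i1 a).integrableOn)]
  refine integral_congr_ae (ae_restrict_of_ae ?_)
  filter_upwards [ae_notMem_finset I] with x hx
  rw [heq x hx, add_mul, Finset.sum_mul]
  congr 1
  · ring
  · refine Finset.sum_congr rfl fun a _ => ?_
    by_cases hxa : x ∈ Ioi a
    · simp only [indicator_of_mem hxa]; ring
    · simp only [indicator_of_notMem hxa]; ring

theorem regular_mul_regular {f g : ℝ → ℝ} (hf : PiecewiseSmooth f) (hg : PiecewiseSmooth g) :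
    (mul ⟨regular f, regular_mem hf⟩ ⟨regular g, regular_mem hg⟩ : Dist)
      = regular fun x => f x * g x := by
  obtain ⟨I, ψ₀, ψ, h₀, hψ, heq⟩ := hg.exists_decomp
  have hG : (⟨regular g, regular_mem hg⟩ : 𝒜) = smoothElem h₀ + ∑ a ∈ I, cutElem a (hψ a) := by
    refine Subtype.ext ?_
    simp only [Submodule.coe_add, Submodule.coe_sum]
    exact regular_eq_decomp h₀ hψ heq
  have hfL := hf.locallyIntegrable
  have l0 : LocallyIntegrable fun x => f x * ψ₀ x := by
    have := hfL.smul_continuous h₀.continuous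
    simpa [mul_comm] using this
  have l1 : ∀ a, LocallyIntegrable fun x => f x * (Ioi a).indicator (ψ a) x := by
    intro a
    have h1 : LocallyIntegrable fun x => f x * ψ a x := by
      have := hfL.smul_continuous (hψ a).continuous
      simpa [mul_comm] using this
    have h2 : (fun x => f x * (Ioi a).indicator (ψ a) x)
        = (Ioi a).indicator fun x => f x * ψ a x := by
      funext x
      by_cases hxa : x ∈ Ioi a <;> simp [indicator, hxa]
    rw [h2]
    exact h1.indicator measurableSet_Ioi
  have hsum := l0.add (locallyIntegrable_sum I fun a _ => l1 a)
  have hae : (fun x => f x * ψ₀ x + ∑ a ∈ I, f x * (Ioi a).indicator (ψ a) x)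
      =ᵐ[volume] fun x => f x * g x := by
    filter_upwards [ae_notMem_finset I] with x hx
    rw [heq x hx, mul_add, Finset.mul_sum]
  refine Eq.trans ?_ (regular_congr (f := fun x => f x * ψ₀ x
    + ∑ a ∈ I, f x * (Ioi a).indicator (ψ a) x) hsum hae)
  rw [regular_add l0 (locallyIntegrable_sum I fun a _ => l1 a), regular_sum I fun a _ => l1 a,
    hG, map_add, map_sum]
  refine dist_ext fun t => ?_
  rw [coe_add_apply, Submodule.coe_sum, sum_apply, add_apply, sum_apply, h.mul_smooth_apply]
  congr 1
  · change regular f _ = _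
    rw [regular_apply hfL, regular_apply l0]
    simp [mul_assoc]
  · refine Finset.sum_congr rfl fun a _ => ?_
    rw [h.regular_mul_cut hf, regular_apply (l1 a), ← integral_indicator measurableSet_Ioi]
    congr 1
    funext x
    by_cases hxa : x ∈ Ioi a <;> simp [indicator, hxa, mul_assoc]

end IsDistProduct

/-! ### Hörmander products with distributions supported at a point -/

/-- Testing gives equality almost everywhere, and continuity gives it everywhere. The finite set N
may be avoided because it is null; this is used at the support of a point distribution. -/
theorem eqOn_of_integral_eq {O : Set ℝ} (hO : IsOpen O) {φ ψ : ℝ → ℝ} (hφ : ContDiffOn ℝ ∞ φ O)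
    (hψ : ContDiffOn ℝ ∞ ψ O) {N : Set ℝ} (hN : N.Finite)
    (h : ∀ t : Test, tsupport t ⊆ O \ N → ∫ x, φ x * t x = ∫ x, ψ x * t x) : EqOn φ ψ O := by
  have hON : IsOpen (O \ N) := hO.sdiff hN.isClosed
  have hφ' := hφ.mono (sdiff_subset (t := N))
  have hψ' := hψ.mono (sdiff_subset (t := N))
  have hae : ∀ᵐ x, x ∈ O \ N → φ x - ψ x = 0 := by
    refine hON.ae_eq_zero_of_integral_contDiff_smul_eq_zero
      ((hφ'.continuousOn.sub hψ'.continuousOn).locallyIntegrableOn hON.measurableSet) ?_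
    intro g hg hgc hgs
    let t : Test := ⟨g, hg, hgc, by simp⟩
    have i1 : Integrable fun x => φ x * t x :=
      (mulTest hON hφ' t hgs).continuous.integrable_of_hasCompactSupport
        (mulTest hON hφ' t hgs).hasCompactSupport
    have i2 : Integrable fun x => ψ x * t x :=
      (mulTest hON hψ' t hgs).continuous.integrable_of_hasCompactSupport
        (mulTest hON hψ' t hgs).hasCompactSupport
    have h1 : ∀ x, g x • (φ x - ψ x) = φ x * t x - ψ x * t x := fun x => by
      change g x * (φ x - ψ x) = φ x * g x - ψ x * g x
      ring
    simp only [h1]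
    rw [integral_sub i1 i2, h t hgs, sub_self]
  refine Measure.eqOn_open_of_ae_eq (μ := volume) ?_ hO hφ.continuousOn hψ.continuousOn
  rw [Filter.EventuallyEq, ae_restrict_iff' hO.measurableSet]
  filter_upwards [hae, compl_mem_ae_iff.2 (hN.measure_zero volume)] with x hx hxN hxO
  exact sub_eq_zero.1 (hx ⟨hxO, hxN⟩)

theorem integral_mul_test_congr {f g : ℝ → ℝ} {W : Set ℝ} (h : EqOn f g W) {t : Test}
    (ht : tsupport t ⊆ W) : ∫ x, f x * t x = ∫ x, g x * t x := by
  congr 1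
  funext x
  by_cases hx : x ∈ tsupport t
  · rw [h (ht hx)]
  · rw [image_eq_zero_of_notMem_tsupport hx, mul_zero, mul_zero]

theorem pointDist_apply_of_notMem {a : ℝ} {G : Dist} (hG : G ∈ pointDist a) {t : Test}
    (ht : a ∉ tsupport t) : G t = 0 := by
  refine pointDist_eq_zero hG ?_
  filter_upwards [(isClosed_tsupport t).isOpen_compl.mem_nhds ht] with x hx
  exact image_eq_zero_of_notMem_tsupport hx

/-- Decomposition of a test function along a finite open covering. -/
theorem exists_test_partition {𝒰 : Set (Set ℝ)} (hfin : 𝒰.Finite) (hcov : ⋃₀ 𝒰 = univ)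
    (hopen : ∀ U ∈ 𝒰, IsOpen U) (t : Test) :
    ∃ s : Set ℝ → Test, (∀ U ∈ 𝒰, tsupport (s U) ⊆ U) ∧ ∑ U ∈ hfin.toFinset, s U = t := by
  classical
  have : Fintype 𝒰 := hfin.fintype
  obtain ⟨ρ, hρ⟩ := SmoothPartitionOfUnity.exists_isSubordinate (modelWithCornersSelf ℝ ℝ)
    (isClosed_univ (X := ℝ)) (fun U : 𝒰 => (U : Set ℝ)) (fun U => hopen U U.2)
    (by rw [← sUnion_eq_iUnion, hcov])
  have hsm : ∀ U : 𝒰, ContDiff ℝ ∞ (ρ U) := fun U => (ρ U).contMDiff.contDiff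
  refine ⟨fun U => if hU : U ∈ 𝒰 then smoothMul (hsm ⟨U, hU⟩) t else 0, fun U hU => ?_, ?_⟩
  · simp only [hU, dif_pos]
    exact (tsupport_mul_subset_left (f := ρ ⟨U, hU⟩) (g := t)).trans (hρ ⟨U, hU⟩)
  · ext x
    have h1 : ∑ U : 𝒰, ρ U x = 1 := by
      rw [← finsum_eq_sum_of_fintype]
      exact ρ.sum_eq_one (mem_univ x)
    have h2 : ∀ (S : Finset (Set ℝ)) (s : Set ℝ → Test), (∑ U ∈ S, s U) x = ∑ U ∈ S, s U x :=
      fun S s => by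
        induction S using Finset.induction_on with
        | empty => simp
        | insert a S ha ih =>
          rw [Finset.sum_insert ha, Finset.sum_insert ha, ← ih]
          rfl
    rw [h2, ← Finset.sum_coe_sort]
    calc _ = ∑ U : 𝒰, ρ U x * t x := by
          refine Fintype.sum_equiv (Equiv.subtypeEquivRight (by simp)) _ _ fun U => ?_
          have hU : (U : Set ℝ) ∈ 𝒰 := by simpa using U.2
          simp only [hU, dif_pos]
          rfl
      _ = t x := by rw [← Finset.sum_mul, h1, one_mul]

theorem IsHormanderProduct.symm {F G P : Dist} (h : IsHormanderProduct F G P) :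
    IsHormanderProduct G F P := by
  obtain ⟨h1, h2, h3, 𝒰, h4, h5, h6⟩ := h
  exact ⟨h2, h1, h3.symm, 𝒰, h4, h5, fun U hU => ⟨(h6 U hU).1, (h6 U hU).2.symm⟩⟩

/-- Uniqueness: whichever covering and smooth representatives are used, the product is the dual
product of G with the smooth function that g equals near z. A partition of unity reduces this to one
member of the covering. -/
theorem IsHormanderProduct.apply_eq {z : ℝ} {G : Dist} (hG : G ∈ pointDist z) {g ψ : ℝ → ℝ}
    (hg : LocallyIntegrable g) {W : Set ℝ} (hW : IsOpen W) (hz : z ∈ W) (hψ : ContDiff ℝ ∞ ψ)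
    (hgψ : EqOn g ψ W) {P : Dist} (hP : IsHormanderProduct (regular g) G P) (t : Test) :
    P t = G (smoothMul hψ t) := by
  obtain ⟨-, -, -, 𝒰, hfin, hcov, hU⟩ := hP
  obtain ⟨s, hs, rfl⟩ := exists_test_partition hfin hcov (fun U h => (hU U h).1) t
  have hlocal : ∀ U ∈ 𝒰, P (s U) = G (smoothMul hψ (s U)) := by
    intro U hU𝒰
    have hsU := hs U hU𝒰
    obtain ⟨hopen, ⟨φ, ⟨hφ, hFφ⟩, hU', hφ', hPU⟩ | ⟨φ, ⟨hφ, hGφ⟩, hU', hφ', hPU⟩⟩ := hU U hU𝒰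
    · rw [hPU (s U) hsU]
      have hEq : EqOn φ ψ (U ∩ W) := by
        refine eqOn_of_integral_eq (hopen.inter hW) (hφ.mono inter_subset_left) hψ.contDiffOn
          finite_empty fun t ht => ?_
        rw [sdiff_empty] at ht
        rw [← hFφ t (ht.trans inter_subset_left), regular_apply hg,
          integral_mul_test_congr hgψ (ht.trans inter_subset_right)]
      refine pointDist_congr hG ?_
      by_cases hzU : z ∈ U
      · filter_upwards [(hopen.inter hW).mem_nhds ⟨hzU, hz⟩] with x hx
        change φ x * s U x = ψ x * s U x
        rw [hEq hx]
      · have hzs : z ∉ tsupport (s U) := fun h => hzU (hsU h)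
        filter_upwards [(isClosed_tsupport (s U)).isOpen_compl.mem_nhds hzs] with x hx
        change φ x * s U x = ψ x * s U x
        rw [image_eq_zero_of_notMem_tsupport hx, mul_zero, mul_zero]
    -- If G is smooth on U, its representative vanishes off z and then also at z by continuity. Both
    -- sides are therefore 0 on test functions supported in U.
    · have hEq : EqOn φ (fun _ => 0) U := by
        refine eqOn_of_integral_eq hopen hφ contDiffOn_const (finite_singleton z) fun t ht => ?_
        rw [← hGφ t (ht.trans sdiff_subset), pointDist_apply_of_notMem hG fun h => (ht h).2 rfl]
        simp
      rw [hPU (s U) hsU]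
      have h0 : mulTest hU' hφ' (s U) hsU = 0 := by
        ext x
        change φ x * s U x = 0
        by_cases hx : x ∈ tsupport (s U)
        · rw [hEq (hsU hx), zero_mul]
        · rw [image_eq_zero_of_notMem_tsupport hx, mul_zero]
      have hsub : tsupport (smoothMul hψ (s U)) ⊆ U :=
        (tsupport_mul_subset_right (f := ψ) (g := s U)).trans hsU
      rw [h0, map_zero, hGφ _ hsub, integral_mul_test_congr (g := fun _ => 0) hEq hsub]
      simp
  have hsum : smoothMul hψ (∑ U ∈ hfin.toFinset, s U)
      = ∑ U ∈ hfin.toFinset, smoothMul hψ (s U) := by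
    let L : Test →+ Test :=
      { toFun := smoothMul hψ
        map_zero' := by ext x; exact mul_zero _
        map_add' := fun u v => by ext x; exact mul_add _ _ _ }
    exact map_sum L s hfin.toFinset
  rw [hsum, map_sum, map_sum]
  exact Finset.sum_congr rfl fun U h => hlocal U (hfin.mem_toFinset.1 h)

/-- Existence: two open sets suffice, W where g is smooth and the complement of z where G vanishes.
This also makes the singular supports disjoint. -/
theorem isHormanderProduct_of_apply_eq {z : ℝ} {G : Dist} (hG : G ∈ pointDist z) {g ψ : ℝ → ℝ}
    (hg : PiecewiseSmooth g) {W : Set ℝ} (hW : IsOpen W) (hz : z ∈ W)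
    (hψ : ContDiff ℝ ∞ ψ) (hgψ : EqOn g ψ W) {P : Dist}
    (hP : ∀ t, P t = G (smoothMul hψ t)) : IsHormanderProduct (regular g) G P := by
  have hgL := hg.locallyIntegrable
  obtain ⟨I, hI, -⟩ := hg
  have hsW : EqSmoothOn (regular g) ψ W := ⟨hψ.contDiffOn, fun t ht => by
    rw [regular_apply hgL, integral_mul_test_congr hgψ ht]⟩
  have hsI : EqSmoothOn (regular g) g (I : Set ℝ)ᶜ := ⟨hI, fun t _ => regular_apply hgL t⟩
  have hsz : EqSmoothOn G (fun _ => 0) {z}ᶜ := ⟨contDiffOn_const, fun t ht => by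
    rw [pointDist_apply_of_notMem hG fun h => ht h rfl]
    simp⟩
  have h1 : singSupp (regular g) ⊆ I := fun x hx => by
    by_contra hxI
    exact hx ⟨(I : Set ℝ)ᶜ, I.finite_toSet.isClosed.isOpen_compl, hxI, g, hsI⟩
  have h2 : singSupp G ⊆ {z} := fun x hx => by
    by_contra hxz
    exact hx ⟨{z}ᶜ, isOpen_compl_singleton, hxz, _, hsz⟩
  refine ⟨I.finite_toSet.subset h1, (finite_singleton z).subset h2, ?_, {W, {z}ᶜ},
    by simp, ?_, ?_⟩
  · rw [disjoint_left]
    intro x hx hx'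
    obtain rfl : x = z := h2 hx'
    exact hx ⟨W, hW, hz, ψ, hsW⟩
  · rw [sUnion_pair, eq_univ_iff_forall]
    intro x
    by_cases hx : x = z
    · exact Or.inl (hx ▸ hz)
    · exact Or.inr hx
  · rintro U (rfl | rfl)
    · refine ⟨hW, Or.inl ⟨ψ, hsW, hW, hψ.contDiffOn, fun t ht => ?_⟩⟩
      rw [hP]
      rfl
    · refine ⟨isOpen_compl_singleton, Or.inr ⟨_, hsz, isOpen_compl_singleton, contDiffOn_const,
        fun t ht => ?_⟩⟩
      have h0 : mulTest (φ := fun _ => 0) isOpen_compl_singleton contDiffOn_const t ht = 0 := by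
        ext x
        exact zero_mul _
      rw [h0, map_zero, hP]
      exact pointDist_apply_of_notMem hG fun h =>
        ht (tsupport_mul_subset_right (f := ψ) (g := t) h) rfl

/-! ### Translations -/

theorem PiecewiseSmooth.comp_add_const {f : ℝ → ℝ} (hf : PiecewiseSmooth f) (c : ℝ) :
    PiecewiseSmooth fun x => f (x + c) := by
  classical
  have hlim := hf.tendsto
  obtain ⟨I, hI, -⟩ := hf
  refine ⟨I.image fun x => x - c, hI.comp (contDiff_id.add contDiff_const).contDiffOn ?_,
    fun x _ n => ?_⟩
  · intro x hx hxI
    exact hx (by simpa using ⟨x + c, hxI, by simp⟩)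
  · rw [iteratedDeriv_comp_add_const]
    obtain ⟨⟨l, hl⟩, r, hr⟩ := hlim (x + c) n
    have hc : Tendsto (fun y => y + c) (𝓝 x) (𝓝 (x + c)) := (continuous_add_const c).tendsto x
    refine ⟨⟨l, hl.comp ?_⟩, ⟨r, hr.comp ?_⟩⟩
    · refine tendsto_nhdsWithin_iff.2 ⟨hc.mono_left nhdsWithin_le_nhds, ?_⟩
      filter_upwards [self_mem_nhdsWithin] with y hy
      exact add_lt_add_left hy c
    · refine tendsto_nhdsWithin_iff.2 ⟨hc.mono_left nhdsWithin_le_nhds, ?_⟩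
      filter_upwards [self_mem_nhdsWithin] with y hy
      exact add_lt_add_left hy c

theorem translate_regular {f : ℝ → ℝ} (hf : PiecewiseSmooth f) (c : ℝ) :
    translate c (regular f) = regular fun x => f (x + c) := by
  refine dist_ext fun t => ?_
  rw [translate_apply, regular_apply hf.locallyIntegrable,
    regular_apply (hf.comp_add_const c).locallyIntegrable,
    ← integral_add_right_eq_self (fun x => f x * shiftTest c t x) c]
  congr 1
  funext x
  change f (x + c) * t (x + c - c) = _
  rw [add_sub_cancel_right]

theorem iterate_Dx_dirac_shiftTest (y c : ℝ) (n : ℕ) (t : Test) :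
    Dx^[n] (dirac y) (shiftTest c t) = (-1) ^ n * iteratedDeriv n t (y - c) := by
  rw [iterate_Dx_dirac_apply]
  congr 1
  exact congrFun (iteratedDeriv_comp_sub_const n t c) y

theorem translate_mem_pointDist {y : ℝ} {G : Dist} (hG : G ∈ pointDist y) (c : ℝ) :
    translate c G ∈ pointDist (y - c) := by
  induction hG using Submodule.span_induction with
  | mem F hF =>
    obtain ⟨n, rfl⟩ := hF
    refine Submodule.subset_span ⟨n, dist_ext fun t => ?_⟩
    simp only
    rw [translate_apply, iterate_Dx_dirac_shiftTest, iterate_Dx_dirac_apply]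
  | zero =>
    have h0 : translate c 0 = 0 := dist_ext fun t => rfl
    rw [h0]
    exact zero_mem _
  | add F G _ _ hF hG =>
    have h0 : translate c (F + G) = translate c F + translate c G := dist_ext fun t => rfl
    rw [h0]
    exact add_mem hF hG
  | smul r F _ hF =>
    have h0 : translate c (r • F) = r • translate c F := dist_ext fun t => rfl
    rw [h0]
    exact Submodule.smul_mem _ r hF

theorem tendsto_pointDist_shiftTest {y : ℝ} {G : Dist} (hG : G ∈ pointDist y) (t : Test) :
    Tendsto (fun ε => G (shiftTest ε t)) (𝓝[>] 0) (𝓝 (G t)) := by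
  induction hG using Submodule.span_induction with
  | mem F hF =>
    obtain ⟨n, rfl⟩ := hF
    have hs : ∀ ε, (fun j : ℕ => Dx^[j] (dirac y)) n (shiftTest ε t)
        = (-1) ^ n * iteratedDeriv n t (y - ε) := fun ε => iterate_Dx_dirac_shiftTest y ε n t
    simp only [hs]
    simp only [iterate_Dx_dirac_apply]
    have hc : Continuous fun ε : ℝ => (-1) ^ n * iteratedDeriv n t (y - ε) :=
      continuous_const.mul (((test_contDiff t).continuous_iteratedDeriv n
        (by exact_mod_cast le_top)).comp (continuous_const.sub continuous_id))
    have := hc.tendsto 0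
    rw [sub_zero] at this
    exact this.mono_left nhdsWithin_le_nhds
  | zero => exact tendsto_const_nhds
  | add F G _ _ hF hG => exact hF.add hG
  | smul r F _ hF => exact hF.const_mul r

theorem contDiff_comp_add_const {ψ : ℝ → ℝ} (hψ : ContDiff ℝ ∞ ψ) (c : ℝ) :
    ContDiff ℝ ∞ fun x => ψ (x + c) := hψ.comp (contDiff_id.add contDiff_const)

theorem tendsto_pointDist_smoothMul {y : ℝ} {G : Dist} (hG : G ∈ pointDist y) {ψ : ℝ → ℝ}
    (hψ : ContDiff ℝ ∞ ψ) (t : Test) :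
    Tendsto (fun ε => G (smoothMul (contDiff_comp_add_const hψ ε) t)) (𝓝[>] 0)
      (𝓝 (G (smoothMul hψ t))) := by
  induction hG using Submodule.span_induction with
  | mem F hF =>
    obtain ⟨n, rfl⟩ := hF
    have hform : ∀ {φ : ℝ → ℝ} (hφ : ContDiff ℝ ∞ φ), Dx^[n] (dirac y) (smoothMul hφ t)
        = (-1) ^ n * ∑ i ∈ Finset.range (n + 1),
          n.choose i * iteratedDeriv i φ y * iteratedDeriv (n - i) t y := by
      intro φ hφ
      rw [iterate_Dx_dirac_apply]
      congr 1
      exact iteratedDeriv_fun_mul (hφ.contDiffAt.of_le (by exact_mod_cast le_top))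
        ((test_contDiff t).contDiffAt.of_le (by exact_mod_cast le_top))
    simp only [hform, iteratedDeriv_comp_add_const]
    have hc : Continuous fun ε : ℝ => (-1) ^ n * ∑ i ∈ Finset.range (n + 1),
        n.choose i * iteratedDeriv i ψ (y + ε) * iteratedDeriv (n - i) t y := by
      refine continuous_const.mul (continuous_finsetSum _ fun i _ => ?_)
      exact (continuous_const.mul ((hψ.continuous_iteratedDeriv i
        (by exact_mod_cast le_top)).comp (continuous_const.add continuous_id))).mul continuous_const
    have := hc.tendsto 0
    simp only [add_zero] at this
    exact this.mono_left nhdsWithin_le_nhds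
  | zero => exact tendsto_const_nhds
  | add F G _ _ hF hG => exact hF.add hG
  | smul r F _ hF => exact hF.const_mul r

/-! ### Star products -/

/-- Uniqueness of the Hörmander product for small ε, together with uniqueness of limits, makes the
star product single-valued. -/
theorem isStarProduct_iff_of_eventually {F G Q : Dist} {H₀ : ℝ → Dist}
    (h₀ : ∀ᶠ ε in 𝓝[>] (0 : ℝ), IsHormanderProduct F (translate ε G) (H₀ ε))
    (huniq : ∀ᶠ ε in 𝓝[>] (0 : ℝ), ∀ P, IsHormanderProduct F (translate ε G) P → P = H₀ ε)
    (hlim : ∀ t : Test, Tendsto (fun ε => H₀ ε t) (𝓝[>] (0 : ℝ)) (𝓝 (Q t))) (P : Dist) :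
    IsStarProduct F G P ↔ P = Q := by
  constructor
  · rintro ⟨H, hH, hP⟩
    refine dist_ext fun t => tendsto_nhds_unique (hP t) ((hlim t).congr' ?_)
    filter_upwards [hH, huniq] with ε h1 h2
    rw [h2 _ h1]
  · rintro rfl
    exact ⟨H₀, h₀, hlim⟩

namespace IsDistProduct

variable {mul : 𝒜 →ₗ[ℝ] 𝒜 →ₗ[ℝ] 𝒜} {D : 𝒜 →ₗ[ℝ] 𝒜} (h : IsDistProduct mul D)
include h

/-- Translation by ε moves the support of G to y − ε, where f agrees with the left branch ψ. As ε
decreases to 0, the translated dual products converge to ψG. -/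
theorem isStarProduct_regular_point_iff {y : ℝ} {f ψ : ℝ → ℝ} {η : ℝ} (hf : PiecewiseSmooth f)
    (hψ : ContDiff ℝ ∞ ψ) (hη : 0 < η) (hfψ : EqOn f ψ (Ioo (y - η) y)) {G : 𝒜}
    (hG : (G : Dist) ∈ pointDist y) (P : Dist) :
    IsStarProduct (regular f) G P ↔ P = (mul (smoothElem hψ) G : Dist) := by
  have hmem : ∀ ε, translate ε (G : Dist) ∈ 𝒜 := fun ε =>
    pointDist_le _ (translate_mem_pointDist hG ε)
  have happ : ∀ ε t, (mul (smoothElem hψ) ⟨_, hmem ε⟩ : Dist) t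
      = translate ε (G : Dist) (smoothMul hψ t) := fun ε t => h.smooth_mul_apply hψ _ t
  have hev : ∀ᶠ ε in 𝓝[>] (0 : ℝ), y - ε ∈ Ioo (y - η) y := by
    filter_upwards [Ioo_mem_nhdsGT hη] with ε hε
    constructor <;> linarith [hε.1, hε.2]
  refine isStarProduct_iff_of_eventually
    (H₀ := fun ε => (mul (smoothElem hψ) ⟨_, hmem ε⟩ : Dist)) ?_ ?_ ?_ P
  · filter_upwards [hev] with ε hε
    exact isHormanderProduct_of_apply_eq (translate_mem_pointDist hG ε) hf isOpen_Ioo hε hψ hfψ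
      (happ ε)
  · filter_upwards [hev] with ε hε P hP
    refine dist_ext fun t => ?_
    rw [happ]
    exact hP.apply_eq (translate_mem_pointDist hG ε) hf.locallyIntegrable isOpen_Ioo hε hψ hfψ t
  · intro t
    simp only [happ]
    rw [h.smooth_mul_apply]
    exact tendsto_pointDist_shiftTest hG _

/-- Here f is translated instead: near y the function f(x + ε) agrees with ψ(x + ε) for the right
branch ψ, and the derivatives of the latter at y converge as ε decreases to 0. -/
theorem isStarProduct_point_regular_iff {y : ℝ} {f ψ : ℝ → ℝ} {η : ℝ} (hf : PiecewiseSmooth f)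
    (hψ : ContDiff ℝ ∞ ψ) (hη : 0 < η) (hfψ : EqOn f ψ (Ioo y (y + η))) {G : 𝒜}
    (hG : (G : Dist) ∈ pointDist y) (P : Dist) :
    IsStarProduct G (regular f) P ↔ P = (mul (smoothElem hψ) G : Dist) := by
  have happ : ∀ ε t, (mul (smoothElem (contDiff_comp_add_const hψ ε)) G : Dist) t
      = (G : Dist) (smoothMul (contDiff_comp_add_const hψ ε) t) := fun ε t =>
    h.smooth_mul_apply _ _ t
  have hev : ∀ᶠ ε in 𝓝[>] (0 : ℝ), y ∈ Ioo (y - ε) (y - ε + η) := by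
    filter_upwards [Ioo_mem_nhdsGT hη] with ε hε
    constructor <;> linarith [hε.1, hε.2]
  have hEq : ∀ ε, EqOn (fun x => f (x + ε)) (fun x => ψ (x + ε)) (Ioo (y - ε) (y - ε + η)) :=
    fun ε x hx => hfψ ⟨by linarith [hx.1], by linarith [hx.2]⟩
  refine isStarProduct_iff_of_eventually
    (H₀ := fun ε => (mul (smoothElem (contDiff_comp_add_const hψ ε)) G : Dist)) ?_ ?_ ?_ P
  · filter_upwards [hev] with ε hε
    rw [translate_regular hf]
    exact (isHormanderProduct_of_apply_eq hG (hf.comp_add_const ε) isOpen_Ioo hε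
      (contDiff_comp_add_const hψ ε) (hEq ε) (happ ε)).symm
  · filter_upwards [hev] with ε hε P hP
    rw [translate_regular hf] at hP
    refine dist_ext fun t => ?_
    rw [happ]
    exact hP.symm.apply_eq hG (hf.comp_add_const ε).locallyIntegrable isOpen_Ioo hε
      (contDiff_comp_add_const hψ ε) (hEq ε) t
  · intro t
    simp only [happ]
    rw [h.smooth_mul_apply]
    exact tendsto_pointDist_smoothMul hG hψ t

/-- The product by a distribution supported at `a`, as a star product. -/
theorem isStarProduct_iff {a : ℝ} {f : ℝ → ℝ} (hf : PiecewiseSmooth f) {G : 𝒜}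
    (hG : (G : Dist) ∈ pointDist a) (P : Dist) :
    (mul (heavisideElem a) (diracElem a 0) = 0 →
      (IsStarProduct (regular f) G P ↔ P = (mul ⟨regular f, regular_mem hf⟩ G : Dist))) ∧
    (mul (heavisideElem a) (diracElem a 0) ≠ 0 →
      (IsStarProduct G (regular f) P ↔ P = (mul ⟨regular f, regular_mem hf⟩ G : Dist))) := by
  obtain ⟨ψl, ψr, η, hψl, hψr, hη, hl, hr⟩ := hf.exists_sides a
  obtain ⟨h1, h2⟩ := h.regular_mul_point hf hψl hψr hη hl hr hG
  constructor
  · intro h0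
    rw [h1 h0]
    exact h.isStarProduct_regular_point_iff hf hψl hη hl hG P
  · intro h0
    rw [h2 h0]
    exact h.isStarProduct_point_regular_iff hf hψr hη hr hG P

/-- Bilinear expansion, in which the products of two singular parts disappear by `point_mul_point`.
-/
theorem mul_eq_of_decomposition {F G : 𝒜} {f g : ℝ → ℝ} {ΔF ΔG : ℝ →₀ Dist}
    (hf : PiecewiseSmooth f) (hg : PiecewiseSmooth g) (hΔF : ∀ x, ΔF x ∈ pointDist x)
    (hΔG : ∀ y, ΔG y ∈ pointDist y) (hF : (F : Dist) = regular f + ∑ x ∈ ΔF.support, ΔF x)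
    (hG : (G : Dist) = regular g + ∑ y ∈ ΔG.support, ΔG y) :
    (mul F G : Dist) = regular (fun x => f x * g x)
      + ∑ y ∈ ΔG.support, (mul ⟨regular f, regular_mem hf⟩ ⟨ΔG y, pointDist_le y (hΔG y)⟩ : Dist)
      + ∑ x ∈ ΔF.support,
        (mul ⟨ΔF x, pointDist_le x (hΔF x)⟩ ⟨regular g, regular_mem hg⟩ : Dist) := by
  have eF : F = ⟨regular f, regular_mem hf⟩
      + ∑ x ∈ ΔF.support, (⟨ΔF x, pointDist_le x (hΔF x)⟩ : 𝒜) := by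
    refine Subtype.ext ?_
    simp only [Submodule.coe_add, Submodule.coe_sum]
    exact hF
  have eG : G = ⟨regular g, regular_mem hg⟩
      + ∑ y ∈ ΔG.support, (⟨ΔG y, pointDist_le y (hΔG y)⟩ : 𝒜) := by
    refine Subtype.ext ?_
    simp only [Submodule.coe_add, Submodule.coe_sum]
    exact hG
  have h0 : ∀ x y, mul ⟨ΔF x, pointDist_le x (hΔF x)⟩ ⟨ΔG y, pointDist_le y (hΔG y)⟩ = 0 :=
    fun x y => h.point_mul_point (hΔF x) (hΔG y)
  rw [eF, eG]
  simp only [map_add, map_sum, LinearMap.add_apply, LinearMap.sum_apply, h0,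
    Finset.sum_const_zero, add_zero, Submodule.coe_add, Submodule.coe_sum,
    h.regular_mul_regular hf hg]
  abel

end IsDistProduct

/-! ### Decompositions and comparison with the product *_M -/

theorem exists_isDecomposition (F : 𝒜) :
    ∃ (f : ℝ → ℝ) (Δ : ℝ →₀ Dist), IsDecomposition F f Δ := by
  have hsum : ∀ Δ : ℝ →₀ Dist, ∑ x ∈ Δ.support, Δ x = Δ.sum fun _ d => d := fun _ => rfl
  induction F using generators_induction with
  | smooth φ hφ =>
    exact ⟨φ, 0, piecewiseSmooth_of_contDiff hφ, fun x => zero_mem _, by simp [smoothElem]⟩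
  | cut a φ hφ =>
    exact ⟨_, 0, piecewiseSmooth_indicator hφ a, fun x => zero_mem _, by simp [cutElem]⟩
  | dirac a n =>
    classical
    refine ⟨fun _ => 0, Finsupp.single a (Dx^[n] (dirac a)),
      piecewiseSmooth_of_contDiff contDiff_const, fun x => ?_, ?_⟩
    · by_cases hx : x = a
      · subst hx
        rw [Finsupp.single_eq_same]
        exact Submodule.subset_span ⟨n, rfl⟩
      · rw [Finsupp.single_eq_of_ne hx]
        exact zero_mem _
    · rw [hsum, Finsupp.sum_single_index rfl, regular_zero, zero_add]
      rfl
  | add F G hF hG =>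
    obtain ⟨f, Δ, h1, h2, h3⟩ := hF
    obtain ⟨g, Δ', h4, h5, h6⟩ := hG
    refine ⟨fun x => f x + g x, Δ + Δ', h1.add h4, fun x => add_mem (h2 x) (h5 x), ?_⟩
    classical
    rw [hsum, Finsupp.sum_add_index' (fun _ => rfl) (fun _ _ _ => rfl), ← hsum, ← hsum,
      regular_add h1.locallyIntegrable h4.locallyIntegrable, Submodule.coe_add, h3, h6]
    abel
  | smul c F hF =>
    obtain ⟨f, Δ, h1, h2, h3⟩ := hF
    refine ⟨fun x => c * f x, c • Δ, h1.const_mul c, fun x => Submodule.smul_mem _ c (h2 x), ?_⟩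
    rw [hsum, Finsupp.sum_smul_index' (fun _ => rfl), regular_smul c h1.locallyIntegrable,
      Submodule.coe_smul, h3, smul_add, Finset.smul_sum]
    rfl

theorem sum_eq_sum_filter_add {ι V : Type*} [AddCommMonoid V] (p : ι → Prop) [DecidablePred p]
    (s : Finset ι) {A S S' : ι → V} (h : ∀ i ∈ s, p i → S i = A i) (h' : ∀ i ∈ s, ¬ p i → S' i = A i) :
    ∑ i ∈ s, A i = ∑ i ∈ s with p i, S i + ∑ i ∈ s with ¬ p i, S' i := by
  rw [← Finset.sum_filter_add_sum_filter_not s p]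
  congr 1
  · refine Finset.sum_congr rfl fun i hi => ?_
    exact (h i (Finset.mem_filter.1 hi).1 (Finset.mem_filter.1 hi).2).symm
  · refine Finset.sum_congr rfl fun i hi => ?_
    exact (h' i (Finset.mem_filter.1 hi).1 (Finset.mem_filter.1 hi).2).symm

/-- Each mixed product of a function and a point distribution is the star product prescribed by
membership of the point in M. From left to right any decomposition is allowed; from right to left
one is constructed. -/
theorem IsDistProduct.isProductM_iff {mul : 𝒜 →ₗ[ℝ] 𝒜 →ₗ[ℝ] 𝒜} {D : 𝒜 →ₗ[ℝ] 𝒜}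
    (h : IsDistProduct mul D) (F G : 𝒜) (P : Dist) :
    IsProductM {a | mul (heavisideElem a) (diracElem a 0) = 0} F G P ↔
      P = (mul F G : Dist) := by
  classical
  have hl : ∀ {f : ℝ → ℝ} (hf : PiecewiseSmooth f) {a : ℝ} {Δ : Dist} (hΔ : Δ ∈ pointDist a)
      (S : Dist), mul (heavisideElem a) (diracElem a 0) = 0 →
      (IsStarProduct (regular f) Δ S ↔
        S = (mul ⟨regular f, regular_mem hf⟩ ⟨Δ, pointDist_le a hΔ⟩ : Dist)) :=
    fun hf a Δ hΔ S => (h.isStarProduct_iff hf (G := ⟨Δ, pointDist_le a hΔ⟩) hΔ S).1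
  have hl' : ∀ {f : ℝ → ℝ} (hf : PiecewiseSmooth f) {a : ℝ} {Δ : Dist} (hΔ : Δ ∈ pointDist a)
      (S : Dist), mul (heavisideElem a) (diracElem a 0) ≠ 0 →
      (IsStarProduct Δ (regular f) S ↔
        S = (mul ⟨regular f, regular_mem hf⟩ ⟨Δ, pointDist_le a hΔ⟩ : Dist)) :=
    fun hf a Δ hΔ S => (h.isStarProduct_iff hf (G := ⟨Δ, pointDist_le a hΔ⟩) hΔ S).2
  -- With the point distribution on the left, the opposite product is used; since it exchanges M
  -- with its complement, the order of the star product is reversed.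
  have hr : ∀ {f : ℝ → ℝ} (hf : PiecewiseSmooth f) {a : ℝ} {Δ : Dist} (hΔ : Δ ∈ pointDist a)
      (S : Dist), mul (heavisideElem a) (diracElem a 0) = 0 →
      (IsStarProduct Δ (regular f) S ↔
        S = (mul ⟨Δ, pointDist_le a hΔ⟩ ⟨regular f, regular_mem hf⟩ : Dist)) :=
    fun hf a Δ hΔ S h0 => (h.flip.isStarProduct_iff hf (G := ⟨Δ, pointDist_le a hΔ⟩) hΔ S).2
      (by rw [ne_eq, h.flip_eq_zero_iff, not_not]; exact h0)
  have hr' : ∀ {f : ℝ → ℝ} (hf : PiecewiseSmooth f) {a : ℝ} {Δ : Dist} (hΔ : Δ ∈ pointDist a)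
      (S : Dist), mul (heavisideElem a) (diracElem a 0) ≠ 0 →
      (IsStarProduct (regular f) Δ S ↔
        S = (mul ⟨Δ, pointDist_le a hΔ⟩ ⟨regular f, regular_mem hf⟩ : Dist)) :=
    fun hf a Δ hΔ S h0 => (h.flip.isStarProduct_iff hf (G := ⟨Δ, pointDist_le a hΔ⟩) hΔ S).1
      ((h.flip_eq_zero_iff a).2 h0)
  set M : Set ℝ := {a | mul (heavisideElem a) (diracElem a 0) = 0} with hM
  have key : ∀ {f g : ℝ → ℝ} {ΔF ΔG : ℝ →₀ Dist} {S₁ S₂ S₃ S₄ : ℝ → Dist}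
      (hf : PiecewiseSmooth f) (hg : PiecewiseSmooth g) (hΔF : ∀ x, ΔF x ∈ pointDist x)
      (hΔG : ∀ y, ΔG y ∈ pointDist y) (_ : (F : Dist) = regular f + ∑ x ∈ ΔF.support, ΔF x)
      (_ : (G : Dist) = regular g + ∑ y ∈ ΔG.support, ΔG y),
      (∀ y ∈ ΔG.support, y ∈ M →
        S₁ y = (mul ⟨regular f, regular_mem hf⟩ ⟨ΔG y, pointDist_le y (hΔG y)⟩ : Dist)) →
      (∀ x ∈ ΔF.support, x ∈ M →
        S₂ x = (mul ⟨ΔF x, pointDist_le x (hΔF x)⟩ ⟨regular g, regular_mem hg⟩ : Dist)) →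
      (∀ y ∈ ΔG.support, y ∉ M →
        S₃ y = (mul ⟨regular f, regular_mem hf⟩ ⟨ΔG y, pointDist_le y (hΔG y)⟩ : Dist)) →
      (∀ x ∈ ΔF.support, x ∉ M →
        S₄ x = (mul ⟨ΔF x, pointDist_le x (hΔF x)⟩ ⟨regular g, regular_mem hg⟩ : Dist)) →
      (mul F G : Dist) = regular (fun x => f x * g x)
        + ∑ y ∈ ΔG.support with y ∈ M, S₁ y + ∑ x ∈ ΔF.support with x ∈ M, S₂ x
        + ∑ y ∈ ΔG.support with y ∉ M, S₃ y + ∑ x ∈ ΔF.support with x ∉ M, S₄ x := by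
    intro f g ΔF ΔG S₁ S₂ S₃ S₄ hf hg hΔF hΔG hF hG h1 h2 h3 h4
    rw [h.mul_eq_of_decomposition hf hg hΔF hΔG hF hG, sum_eq_sum_filter_add (· ∈ M) _ h1 h3,
      sum_eq_sum_filter_add (· ∈ M) _ h2 h4]
    abel
  constructor
  · rintro ⟨f, g, ΔF, ΔG, S₁, S₂, S₃, S₄, ⟨hf, hΔF, hF⟩, ⟨hg, hΔG, hG⟩, h1, h2, h3, h4, rfl⟩
    exact ((key hf hg hΔF hΔG hF hG
      (fun y hy hyM => (hl hf (hΔG y) _ hyM).1 (h1 y hy hyM))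
      (fun x hx hxM => (hr hg (hΔF x) _ hxM).1 (h2 x hx hxM))
      (fun y hy hyM => (hl' hf (hΔG y) _ hyM).1 (h3 y hy hyM))
      (fun x hx hxM => (hr' hg (hΔF x) _ hxM).1 (h4 x hx hxM))).trans (by congr!)).symm
  · rintro rfl
    obtain ⟨f, ΔF, hf, hΔF, hF⟩ := exists_isDecomposition F
    obtain ⟨g, ΔG, hg, hΔG, hG⟩ := exists_isDecomposition G
    exact ⟨f, g, ΔF, ΔG, _, _, _, _, ⟨hf, hΔF, hF⟩, ⟨hg, hΔG, hG⟩,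
      fun y _ hy => (hl hf (hΔG y) _ hy).2 rfl,
      fun x _ hx => (hr hg (hΔF x) _ hx).2 rfl,
      fun y _ hy => (hl' hf (hΔG y) _ hy).2 rfl,
      fun x _ hx => (hr' hg (hΔF x) _ hx).2 rfl,
      (key hf hg hΔF hΔG hF hG (fun _ _ _ => rfl) (fun _ _ _ => rfl) (fun _ _ _ => rfl)
        (fun _ _ _ => rfl)).trans (by congr!)⟩

end DistAlg

theorem corollary1
    -- a bilinear product on `𝒜`
    (mul : DistAlg.𝒜 →ₗ[ℝ] DistAlg.𝒜 →ₗ[ℝ] DistAlg.𝒜)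
    -- it is associative
    (mul_assoc : ∀ F G J : DistAlg.𝒜, mul (mul F G) J = mul F (mul G J))
    -- (A2) the function `1` is the identity
    (A2 : ∀ F : DistAlg.𝒜, mul DistAlg.one F = F ∧ mul F DistAlg.one = F)
    -- (A3) a linear derivative operator with the Leibniz rule that coincides with `D_x`
    (A3 : ∃ D : DistAlg.𝒜 →ₗ[ℝ] DistAlg.𝒜,
      (∀ F G : DistAlg.𝒜, D (mul F G) = mul (D F) G + mul F (D G)) ∧
      (∀ F : DistAlg.𝒜, (D F : DistAlg.Dist) = DistAlg.Dx (F : DistAlg.Dist)))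
    -- (A4) the product of continuous functions is the usual one
    (A4 : ∀ (F G : DistAlg.𝒜) (f g : ℝ → ℝ), Continuous f → Continuous g →
      (F : DistAlg.Dist) = DistAlg.regular f → (G : DistAlg.Dist) = DistAlg.regular g →
      (mul F G : DistAlg.Dist) = DistAlg.regular (fun x => f x * g x)) :
    -- `mul` and `*_M` have the same graph
    ∃ M : Set ℝ, ∀ (F G : DistAlg.𝒜) (P : DistAlg.Dist),
      DistAlg.IsProductM M (F : DistAlg.Dist) (G : DistAlg.Dist) P ↔
        P = (mul F G : DistAlg.Dist) := by
  obtain ⟨D, hleib, hD⟩ := A3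
  exact ⟨_, (DistAlg.IsDistProduct.mk mul_assoc hleib hD A4).isProductM_iff⟩
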